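/- Let $k$ be a field, let $Q$ be a finite connected (in particular non-empty) quiver with set of vertices $Q_0$ and set of arrows $Q_1$, let $kQ$ be its path algebra and let $F$ be the two-sided ideal of $kQ$ generated by the arrows. Let $I$ be an admissible ideal of $kQ$, that is, a two-sided ideal with $F^m\subseteq I\subseteq F^2$ for some $m\ge 2$, and let $A=kQ/I$. Assume that $A$ is - monomial: $I$ is generated, as a two-sided ideal, by a set of paths; - semi-commutative: whenever $w,w'$ are paths of $Q$ (stationary paths $e_x$ included) with the same source and the same target, $w\in I$ if and only if $w'\in I$; - schurian: $\dim_k e_xAe_y\le 1$ for all $x,y\in Q_0$. Let $\mathrm{HH}^i(A)=\mathrm{Ext}^i_{A^e}(A,A)$, where $A^e=A\otimes_k A^{\mathrm{op}}$, be the Hochschild cohomology of $A$. Then: a) $\mathrm{HH}^0(A)\cong k$ as $k$-vector spaces; b) $\mathrm{HH}^1(A)$ is finite-dimensional and $\dim_k \mathrm{HH}^1(A)=\chi(Q)$, where $\chi(Q)=1-|Q_0|+|Q_1|$; c) $\mathrm{HH}^i(A)=0$ for all $i\ge 2$. -/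

import Mathlib

open CategoryTheory TensorProduct

universe u v w

/-- The paths of a quiver `Q` (of all lengths, one stationary path at each vertex included),
with their source and target. -/
abbrev QPath (Q : Type u) [Quiver.{v} Q] : Type (max u v) :=
  Σ x : Q, Σ y : Q, Quiver.Path x y

/-- The path algebra `kQ`: the `k`-vector space with basis all the paths of `Q`. -/
def PathAlgebra (k : Type w) [Field k] (Q : Type u) [Quiver.{v} Q] : Type (max u v w) :=
  QPath Q →₀ k

namespace PathAlgebra

variable {k : Type w} [Field k] {Q : Type u} [Quiver.{v} Q]

noncomputable instance : AddCommGroup (PathAlgebra k Q) :=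
  inferInstanceAs (AddCommGroup (QPath Q →₀ k))

noncomputable instance : Module k (PathAlgebra k Q) :=
  inferInstanceAs (Module k (QPath Q →₀ k))

variable (k) in
/-- The basis of the path algebra formed by the paths. -/
noncomputable def pathBasis (Q : Type u) [Quiver.{v} Q] :
    Module.Basis (QPath Q) k (PathAlgebra k Q) :=
  ⟨LinearEquiv.refl k (QPath Q →₀ k)⟩

variable (k) in
/-- A path, as an element of the path algebra. -/
noncomputable def ofPath {x y : Q} (p : Quiver.Path x y) : PathAlgebra k Q :=
  pathBasis k Q ⟨x, y, p⟩

variable (k) in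
/-- The stationary path `e_x`. -/
noncomputable def vertex (x : Q) : PathAlgebra k Q :=
  ofPath k (Quiver.Path.nil : Quiver.Path x x)

open Classical in
variable (k) in
/-- The product of two paths: `p q` is first `p`, then `q`, if the target of `p` is
the source of `q`, and it is `0` otherwise. -/
noncomputable def pathMul (p q : QPath Q) : PathAlgebra k Q :=
  if h : p.2.1 = q.1 then ofPath k (p.2.2.comp (q.2.2.cast h.symm rfl)) else 0

/-- The bilinear extension of the product of paths. -/
noncomputable def mulMap :
    PathAlgebra k Q →ₗ[k] PathAlgebra k Q →ₗ[k] PathAlgebra k Q :=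
  (pathBasis k Q).constr k fun p => (pathBasis k Q).constr k fun q => pathMul k p q

noncomputable instance : Mul (PathAlgebra k Q) := ⟨fun a b => mulMap a b⟩

theorem mul_def (a b : PathAlgebra k Q) : a * b = mulMap a b := rfl

theorem pathBasis_mul (p q : QPath Q) :
    pathBasis k Q p * pathBasis k Q q = pathMul k p q := by
  simp [mul_def, mulMap, Module.Basis.constr_basis]

theorem ofPath_mul_ofPath {x y z : Q} (p : Quiver.Path x y) (q : Quiver.Path y z) :
    ofPath k p * ofPath k q = ofPath k (p.comp q) := by
  simp [ofPath, pathBasis_mul, pathMul]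

theorem ofPath_mul_ofPath_of_ne {x y y' z : Q} (h : y ≠ y') (p : Quiver.Path x y)
    (q : Quiver.Path y' z) : ofPath k p * ofPath k q = 0 := by
  simp [ofPath, pathBasis_mul, pathMul, h]

theorem path_induction {P : PathAlgebra k Q → Prop} (a : PathAlgebra k Q) (h0 : P 0)
    (hadd : ∀ a b, P a → P b → P (a + b))
    (hsmul : ∀ (c : k) {x y : Q} (p : Quiver.Path x y), P (c • ofPath k p)) : P a := by
  have ha : a ∈ Submodule.span k (Set.range (pathBasis k Q)) := by
    rw [(pathBasis k Q).span_eq]; trivial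
  rw [← Set.image_univ] at ha
  refine Submodule.closure_induction (p := fun a _ => P a) h0 (fun a b _ _ => hadd a b) ?_ ha
  rintro c _ ⟨⟨x, y, p⟩, -, rfl⟩
  exact hsmul c p

theorem zero_mul_aux (a : PathAlgebra k Q) : 0 * a = 0 := by simp [mul_def]

theorem mul_zero_aux (a : PathAlgebra k Q) : a * 0 = 0 := by simp [mul_def]

theorem add_mul_aux (a b c : PathAlgebra k Q) : (a + b) * c = a * c + b * c := by
  simp [mul_def]

theorem mul_add_aux (a b c : PathAlgebra k Q) : a * (b + c) = a * b + a * c := by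
  simp [mul_def]

theorem smul_mul_aux (r : k) (a b : PathAlgebra k Q) : (r • a) * b = r • (a * b) := by
  simp [mul_def]

theorem mul_smul_aux (r : k) (a b : PathAlgebra k Q) : a * (r • b) = r • (a * b) := by
  simp [mul_def]

theorem mul_assoc_aux (a b c : PathAlgebra k Q) : a * b * c = a * (b * c) := by
  induction a using path_induction with
  | h0 => simp only [zero_mul_aux]
  | hadd a a' ha ha' => simp only [add_mul_aux, ha, ha']
  | @hsmul r x y p =>
    induction b using path_induction with
    | h0 => simp only [zero_mul_aux, mul_zero_aux]
    | hadd b b' hb hb' => simp only [add_mul_aux, mul_add_aux, hb, hb']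
    | @hsmul s x' y' q =>
      induction c using path_induction with
      | h0 => simp only [mul_zero_aux]
      | hadd c c' hc hc' => simp only [mul_add_aux, hc, hc']
      | @hsmul t x'' y'' m =>
        simp only [smul_mul_aux, mul_smul_aux]
        by_cases h : y = x'
        · subst h
          by_cases h' : y' = x''
          · subst h'
            simp only [ofPath_mul_ofPath, Quiver.Path.comp_assoc]
          · simp only [ofPath_mul_ofPath, ofPath_mul_ofPath_of_ne h', mul_zero_aux]
        · by_cases h' : y' = x''
          · subst h'
            simp only [ofPath_mul_ofPath, ofPath_mul_ofPath_of_ne h, zero_mul_aux]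
          · simp only [ofPath_mul_ofPath_of_ne h, ofPath_mul_ofPath_of_ne h', zero_mul_aux,
              mul_zero_aux]

variable [Fintype Q]

noncomputable instance : One (PathAlgebra k Q) := ⟨∑ x : Q, vertex k x⟩

theorem one_def : (1 : PathAlgebra k Q) = ∑ x : Q, vertex k x := rfl

theorem one_mul_aux (a : PathAlgebra k Q) : 1 * a = a := by
  induction a using path_induction with
  | h0 => exact mul_zero_aux _
  | hadd a a' ha ha' => rw [mul_add_aux, ha, ha']
  | @hsmul r x y p =>
    rw [mul_smul_aux, one_def, mul_def, map_sum, LinearMap.sum_apply,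
      Finset.sum_eq_single_of_mem x (Finset.mem_univ x)]
    · rw [← mul_def, vertex, ofPath_mul_ofPath, Quiver.Path.nil_comp]
    · intro z _ hz
      rw [← mul_def, vertex, ofPath_mul_ofPath_of_ne hz]

theorem mul_one_aux (a : PathAlgebra k Q) : a * 1 = a := by
  induction a using path_induction with
  | h0 => exact zero_mul_aux _
  | hadd a a' ha ha' => rw [add_mul_aux, ha, ha']
  | @hsmul r x y p =>
    rw [smul_mul_aux, one_def, mul_def, map_sum,
      Finset.sum_eq_single_of_mem y (Finset.mem_univ y)]
    · rw [← mul_def, vertex, ofPath_mul_ofPath, Quiver.Path.comp_nil]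
    · intro z _ hz
      rw [← mul_def, vertex, ofPath_mul_ofPath_of_ne hz.symm]

/-- The path algebra of a quiver with finitely many vertices; its unit is the sum of the
stationary paths. -/
noncomputable instance : Ring (PathAlgebra k Q) :=
  { (inferInstance : AddCommGroup (PathAlgebra k Q)) with
    mul := (· * ·)
    one := 1
    zero_mul := zero_mul_aux
    mul_zero := mul_zero_aux
    left_distrib := mul_add_aux
    right_distrib := add_mul_aux
    mul_assoc := mul_assoc_aux
    one_mul := one_mul_aux
    mul_one := mul_one_aux }

noncomputable instance : Algebra k (PathAlgebra k Q) :=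
  Algebra.ofModule smul_mul_aux (fun r a b => mul_smul_aux r a b)

end PathAlgebra

namespace BoundQuiver

open PathAlgebra

variable {k : Type w} [Field k] {Q : Type u} [Quiver.{v} Q]

variable (Q) in
/-- The underlying graph of `Q` is connected: it is non-empty and any two vertices are joined
by a walk, that is, by a path in arrows and formal inverses of arrows. -/
def IsConnected : Prop :=
  Nonempty Q ∧ ∀ x y : Quiver.Symmetrify Q, Nonempty (Quiver.Path x y)

variable [Fintype Q]

variable (k Q) in
/-- The two-sided ideal `F` of `kQ` generated by the arrows. -/
noncomputable def arrowIdeal : Ideal (PathAlgebra k Q) :=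
  (TwoSidedIdeal.span
    {a : PathAlgebra k Q | ∃ (x y : Q) (α : x ⟶ y), a = ofPath k α.toPath}).asIdeal

/-- An ideal `I` of `kQ` is admissible if `F ^ m ⊆ I ⊆ F ^ 2` for some `m ≥ 2`. -/
def IsAdmissible (I : Ideal (PathAlgebra k Q)) : Prop :=
  ∃ m : ℕ, 2 ≤ m ∧ arrowIdeal k Q ^ m ≤ I ∧ I ≤ arrowIdeal k Q ^ 2

/-- The ideal `I` is monomial: as a two-sided ideal it is generated by a set of paths. -/
def IsMonomial (I : Ideal (PathAlgebra k Q)) : Prop :=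
  ∃ S : Set (QPath Q), I = (TwoSidedIdeal.span (pathBasis k Q '' S)).asIdeal

/-- `A = kQ/I` is semi-commutative: of two parallel paths, if one lies in `I`, so does the
other. -/
def IsSemicommutative (I : Ideal (PathAlgebra k Q)) : Prop :=
  ∀ ⦃x y : Q⦄ (p q : Quiver.Path x y), ofPath k p ∈ I ↔ ofPath k q ∈ I

/-- The subspace `e_x A e_y` of `A = kQ/I`. -/
noncomputable def peirce (I : Ideal (PathAlgebra k Q)) [I.IsTwoSided] (x y : Q) :
    Submodule k (PathAlgebra k Q ⧸ I) :=
  LinearMap.range (LinearMap.mulLeftRight k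
    ((Ideal.Quotient.mk I (vertex k x) : PathAlgebra k Q ⧸ I),
      (Ideal.Quotient.mk I (vertex k y) : PathAlgebra k Q ⧸ I)))

/-- `A = kQ/I` is schurian: `dim_k e_x A e_y ≤ 1` for all vertices `x`, `y`. -/
def IsSchurian (I : Ideal (PathAlgebra k Q)) [I.IsTwoSided] : Prop :=
  ∀ x y : Q, Module.rank k (peirce I x y) ≤ 1

end BoundQuiver

/-- `A` as a module over its enveloping algebra: `(a ⊗ b) • m = a * m * b`. -/
noncomputable def envelopingBimodule (k : Type w) [Field k] (A : Type u) [Ring A]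
    [Algebra k A] : ModuleCat.{u} (A ⊗[k] Aᵐᵒᵖ) :=
  letI : Module (A ⊗[k] Aᵐᵒᵖ) A := TensorProduct.Algebra.module
  ModuleCat.of (A ⊗[k] Aᵐᵒᵖ) A

/-- The Hochschild cohomology `HH^i(A) = Ext^i_{A^e}(A, A)`, with `A^e = A ⊗ A^op`. -/
abbrev HochschildCohomology (k : Type w) [Field k] (A : Type u) [Ring A] [Algebra k A]
    (i : ℕ) : Type u :=
  Abelian.Ext.{u} (envelopingBimodule k A) (envelopingBimodule k A) i

-- Write $R=A^e$. Under the three hypotheses a path outside $I$ is the only path between its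
-- endpoints (`path_unique`), and the classes of these paths form a basis of $A$. Let $e$, $d$,
-- $f\in R$ be the sums of the $e_x\otimes e_y$ over the pairs $x=y$, the pairs joined by an arrow,
-- and the pairs joined by a path lying in $I$. Let $t=\sum(\alpha\otimes e_y-e_x\otimes\alpha)$
-- over the arrows $\alpha:x\to y$. Right multiplication by $t$ gives the start of a bimodule
-- resolution, $0\to K\to Rd\to Re\to A\to 0$; exactness at $Re$ is a telescoping argument
-- (`exists_mul_arrowDiff_eq`).
--
-- The point is that $K$ is invisible to $A$. If $rt=0$, comparing coefficients of
-- $p\beta\otimes\alpha q$ shows that $r$ has the same coefficient at $p\beta\otimes q$ and at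
-- $p\otimes\alpha q$. While $p\beta\alpha q\ne 0$ in $A$, arrows can thus be moved to the right
-- until the left factor is stationary, where the coefficient vanishes. So $rd$ only involves terms
-- $p\otimes q$ with $p\alpha q\in I$, which says $fK=K$ (`pairIdem_mul_eq_of_mul_arrowDiff`). On
-- the other hand $fA=0$, since parallel paths vanish together, and $fRf=Rf$, since a path
-- containing a zero path is zero. Hence $K$ is resolved by sums of copies of $Rf$, and
-- $\mathrm{Hom}(Rf,A)=fA=0$ gives $\mathrm{Ext}^*(K,A)=0$ (`subsingleton_ext_of_idempotent`).
--
-- Shifting twice kills $\mathrm{Ext}^i(A,A)$ for $i\ge 2$. In degree one, $\mathrm{Hom}(Re,A)=eA$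
-- has dimension $|Q_0|$, $\mathrm{Hom}(Rd,A)=dA$ has dimension $|Q_1|$, and $\mathrm{End}(A)$ is
-- the centre, equal to $k$ by connectedness. The count is assembled in
-- `ext_of_idempotent_presentation`.

universe t

/-! ### Dimension shifting for Ext along a short exact sequence. -/

section Homological

open CategoryTheory.Abelian CategoryTheory.Limits

variable {C : Type u} [Category.{v} C] [Abelian C]

/-- If `Hom(X₁, Y) = 0` then `Hom(X₃, Y) = Hom(X₂, Y)`. -/
theorem nonempty_hom_linearEquiv_of_shortExact {k : Type*} [Field k] [Linear k C]
    {S : ShortComplex C} (hS : S.ShortExact) (Y : C) (h : Subsingleton (S.X₁ ⟶ Y)) :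
    Nonempty ((S.X₃ ⟶ Y) ≃ₗ[k] (S.X₂ ⟶ Y)) := by
  have := hS.epi_g
  refine ⟨LinearEquiv.ofBijective (Linear.leftComp k Y S.g) ⟨?_, ?_⟩⟩
  · intro a b hab
    exact (cancel_epi S.g).1 hab
  · intro φ
    exact ⟨hS.exact.desc φ (Subsingleton.elim _ _), hS.exact.g_desc φ _⟩

variable [HasExt.{w} C]

theorem subsingleton_ext_succ_of_shortExact {S : ShortComplex C} (hS : S.ShortExact)
    [Projective S.X₂] (Y : C) (n : ℕ) (h : Subsingleton (Ext S.X₁ Y n)) :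
    Subsingleton (Ext S.X₃ Y (n + 1)) := by
  refine subsingleton_of_forall_eq 0 fun x => ?_
  obtain ⟨y, rfl⟩ := Ext.contravariant_sequence_exact₃ hS Y x
    (Ext.eq_zero_of_projective _) (add_comm 1 n)
  rw [Subsingleton.elim y 0, Ext.comp_zero]

/-- The dimension count on the exact sequence
`0 → Hom(X₃, Y) → Hom(X₂, Y) → Hom(X₁, Y) → Ext¹(X₃, Y) → 0` with `X₂` projective. -/
theorem finrank_ext_one_of_shortExact {k : Type*} [Field k] [Linear k C] {S : ShortComplex C}
    (hS : S.ShortExact) [Projective S.X₂] (Y : C) [Module.Finite k (S.X₁ ⟶ Y)]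
    [Module.Finite k (S.X₂ ⟶ Y)] :
    Module.Finite k (Ext S.X₃ Y 1) ∧
      Module.finrank k (Ext S.X₃ Y 1) + Module.finrank k (S.X₂ ⟶ Y) =
        Module.finrank k (S.X₁ ⟶ Y) + Module.finrank k (S.X₃ ⟶ Y) := by
  -- The connecting map, onto because $\mathrm{Ext}^1(X_2,Y)=0$; two applications of rank-nullity
  -- then give the count.
  let d : (S.X₁ ⟶ Y) →ₗ[k] Ext S.X₃ Y 1 :=
    Ext.bilinearCompOfLinear k S.X₃ S.X₁ Y 1 0 1 rfl hS.extClass ∘ₗ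
      (Ext.linearEquiv₀ (R := k)).symm.toLinearMap
  have hd : ∀ φ, d φ = hS.extClass.comp (Ext.mk₀ φ) rfl := fun φ => rfl
  have hsurj : Function.Surjective d := by
    intro x
    obtain ⟨y, hy⟩ := Ext.contravariant_sequence_exact₃ hS Y x
      (Ext.eq_zero_of_projective _) (add_comm 1 0)
    obtain ⟨φ, rfl⟩ := (Ext.mk₀_bijective _ _).2 y
    exact ⟨φ, hy⟩
  have hker : LinearMap.ker d = LinearMap.range (Linear.leftComp k Y S.f) := by
    ext φ
    rw [LinearMap.mem_ker, hd, LinearMap.mem_range]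
    constructor
    · intro h
      obtain ⟨y, hy⟩ := Ext.contravariant_sequence_exact₁ hS Y (Ext.mk₀ φ) rfl h
      obtain ⟨ψ, rfl⟩ := (Ext.mk₀_bijective _ _).2 y
      refine ⟨ψ, (Ext.mk₀_bijective _ _).1 ?_⟩
      rw [← hy, Ext.mk₀_comp_mk₀, Linear.leftComp_apply]
    · rintro ⟨ψ, rfl⟩
      rw [Linear.leftComp_apply, ← Ext.mk₀_comp_mk₀, hS.extClass_comp_assoc]
  have hinj : Function.Injective (Linear.leftComp k Y S.g) := by
    have := hS.epi_g
    intro a b hab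
    exact (cancel_epi S.g).1 hab
  have hmid : LinearMap.ker (Linear.leftComp k Y S.f) =
      LinearMap.range (Linear.leftComp k Y S.g) := by
    have := hS.epi_g
    ext φ
    rw [LinearMap.mem_ker, LinearMap.mem_range, Linear.leftComp_apply]
    constructor
    · intro h
      exact ⟨hS.exact.desc φ h, hS.exact.g_desc φ h⟩
    · rintro ⟨ψ, rfl⟩
      rw [Linear.leftComp_apply, S.zero_assoc, zero_comp]
  have hfin : Module.Finite k (Ext S.X₃ Y 1) := Module.Finite.of_surjective d hsurj
  refine ⟨hfin, ?_⟩
  have h1 := LinearMap.finrank_range_add_finrank_ker d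
  have h2 := LinearMap.finrank_range_add_finrank_ker (Linear.leftComp k Y S.f)
  rw [LinearMap.range_eq_top.2 hsurj, finrank_top, hker] at h1
  rw [hmid, LinearMap.finrank_range_of_inj hinj] at h2
  omega

end Homological

/-! ### Modules presented by idempotents. -/

section Idempotents

variable {R : Type v} [Ring R]

theorem mul_idempotent_of_mem_span {e r : R} (he : IsIdempotentElem e)
    (hr : r ∈ Ideal.span {e}) : r * e = r := by
  obtain ⟨s, rfl⟩ := Ideal.mem_span_singleton'.1 hr
  rw [mul_assoc, he]

theorem projective_span_idempotent {e : R} (he : IsIdempotentElem e) :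
    Module.Projective R (Ideal.span {e}) := by
  refine Module.Projective.of_split (Submodule.subtype _)
    (LinearMap.codRestrict (Ideal.span {e}) (LinearMap.toSpanSingleton R R e)
      fun r => Ideal.mem_span_singleton'.2 ⟨r, rfl⟩) ?_
  ext r
  simpa using mul_idempotent_of_mem_span he r.2

/-- The map `R e → M` sending `r` to `r • m`. -/
def cyclicCover (e : R) {M : Type*} [AddCommGroup M] [Module R M] (m : M) :
    Ideal.span {e} →ₗ[R] M :=
  LinearMap.toSpanSingleton R M m ∘ₗ Submodule.subtype _

theorem cyclicCover_apply (e : R) {M : Type*} [AddCommGroup M] [Module R M] (m : M)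
    (r : Ideal.span {e}) : cyclicCover e m r = (r : R) • m := rfl

theorem cyclicCover_surjective {e : R} {M : Type*} [AddCommGroup M] [Module R M] {m : M}
    (hm : e • m = m) (hgen : ∀ x : M, ∃ r : R, r • m = x) :
    Function.Surjective (cyclicCover e m) := by
  intro x
  obtain ⟨r, rfl⟩ := hgen x
  exact ⟨⟨r * e, Ideal.mem_span_singleton'.2 ⟨r, rfl⟩⟩, by
    rw [cyclicCover_apply, mul_smul, hm]⟩

open CategoryTheory.Abelian in
/-- If `f R f = R f`, there are no extensions of the modules `M` with `f M = M` by the modules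
`N` with `f N = 0`. -/
theorem subsingleton_ext_of_idempotent {f : R} (hf : IsIdempotentElem f)
    (hRf : ∀ r : R, f * (r * f) = r * f) (N : ModuleCat.{v} R) (hN : ∀ x : N, f • x = 0) (n : ℕ) :
    ∀ (M : ModuleCat.{v} R), (∀ x : M, f • x = x) → Subsingleton (Ext.{v} M N n) := by
  induction n with
  | zero =>
    intro M hM
    refine (Ext.homEquiv₀ (X := M) (Y := N)).subsingleton_congr.2
      (subsingleton_of_forall_eq 0 fun φ => ?_)
    ext x
    change φ.hom x = 0
    rw [← hM x, map_smul, hN]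
  | succ n ih =>
    intro M hM
    have := projective_span_idempotent hf
    -- One copy of $Rf$ for each $m\in M$, mapped by $r\mapsto rm$; it hits $m$ because $fm=m$.
    let g : (M →₀ Ideal.span {f}) →ₗ[R] M := Finsupp.lsum ℕ fun m => cyclicCover f m
    have hg : Function.Surjective g := by
      intro m
      refine ⟨Finsupp.single m ⟨f, Ideal.mem_span_singleton_self f⟩, ?_⟩
      simp [g, cyclicCover_apply, hM]
    have : Projective g.shortComplexKer.X₂ :=
      have : Module.Projective R (M →₀ Ideal.span {f}) := by
        classical exact Module.Projective.of_equiv' (finsuppLequivDFinsupp R).symm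
      inferInstanceAs (Projective (ModuleCat.of R (M →₀ Ideal.span {f})))
    refine subsingleton_ext_succ_of_shortExact (LinearMap.shortExact_shortComplexKer hg) N n
      (ih _ ?_)
    -- The kernel is again fixed by $f$, because $fRf=Rf$ makes $f$ act as the identity on every
    -- copy of $Rf$.
    rintro ⟨x, hx⟩
    refine Subtype.ext ?_
    change f • x = x
    ext m
    rw [Finsupp.smul_apply]
    change f * (x m : R) = x m
    rw [← mul_idempotent_of_mem_span hf (x m).2, hRf]

-- Evaluation at $e$ identifies $\mathrm{Hom}(Re,N)$ with $eN$, of which the family $b$ is a basis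
-- by `hb` and `huniq`.
open scoped ModuleCat in
theorem nonempty_hom_span_idempotent_linearEquiv {k : Type*} [Field k] [Algebra k R] {e : R}
    (he : IsIdempotentElem e) (N : ModuleCat.{v} R) {ι : Type*} [Fintype ι] (b : ι → N)
    (hb : ∀ i, e • b i = b i)
    (huniq : ∀ x : N, e • x = x → ∃! c : ι → k, ∑ i, algebraMap k R (c i) • b i = x) :
    Nonempty ((ModuleCat.of R (Ideal.span {e}) ⟶ N) ≃ₗ[k] (ι → k)) := by
  let G : (ModuleCat.of R (Ideal.span {e}) ⟶ N) →ₗ[k] N :=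
    { toFun := fun φ => φ.hom ⟨e, Ideal.mem_span_singleton_self e⟩
      map_add' := fun _ _ => rfl
      map_smul' := fun _ _ => rfl }
  let F : (ι → k) →ₗ[k] N := Fintype.linearCombination k b
  have hF : ∀ c, F c = ∑ i, algebraMap k R (c i) • b i := fun c => rfl
  have hFe : ∀ c, e • F c = F c := by
    intro c
    rw [hF, Finset.smul_sum]
    refine Finset.sum_congr rfl fun i _ => ?_
    rw [smul_smul, ← Algebra.commutes, mul_smul, hb]
  have hGe : ∀ φ, e • G φ = G φ := by
    intro φ
    change e • φ.hom _ = φ.hom _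
    rw [← map_smul]
    congr 1
    exact Subtype.ext he
  have hGinj : Function.Injective G := by
    intro φ ψ h
    ext ⟨x, hx⟩
    obtain ⟨r, rfl⟩ := Ideal.mem_span_singleton'.1 hx
    have : (⟨r * e, hx⟩ : Ideal.span {e}) = r • ⟨e, Ideal.mem_span_singleton_self e⟩ := rfl
    change φ.hom _ = ψ.hom _
    rw [this, map_smul, map_smul]
    exact congrArg (r • ·) h
  have hFinj : Function.Injective F := by
    intro c d h
    exact (huniq (F d) (hFe d)).unique h rfl
  have hrange : LinearMap.range G = LinearMap.range F := by
    ext x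
    constructor
    · rintro ⟨φ, rfl⟩
      exact (huniq (G φ) (hGe φ)).exists
    · rintro ⟨c, rfl⟩
      exact ⟨ModuleCat.ofHom (cyclicCover e (F c)), hFe c⟩
  exact ⟨LinearEquiv.ofInjective G hGinj ≪≫ₗ LinearEquiv.ofEq _ _ hrange ≪≫ₗ
    (LinearEquiv.ofInjective F hFinj).symm⟩

open CategoryTheory.Abelian in
/-- The self-extensions of a cyclic module `N = R n₀` for which there is an exact sequence
`0 → K → R d → R e → N → 0` with `K = f K`, `f N = 0` and `f R f = R f`. -/
theorem ext_of_idempotent_presentation {k : Type*} [Field k] [Algebra k R] {e d f t : R}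
    (he : IsIdempotentElem e) (hd : IsIdempotentElem d) (hf : IsIdempotentElem f)
    (hRf : ∀ r : R, f * (r * f) = r * f) (hdt : d * t = t) (hte : t * e = t)
    (N : ModuleCat.{v} R) (hN : ∀ x : N, f • x = 0) {n₀ : N} (hn₀ : e • n₀ = n₀)
    (hgen : ∀ x : N, ∃ r : R, r • n₀ = x) (htn : t • n₀ = 0)
    (hexact : ∀ r : R, r • n₀ = 0 → ∃ s, s * t = r * e)
    (hker : ∀ r : R, r * t = 0 → f * (r * d) = r * d)
    {ι κ : Type*} [Fintype ι] [Fintype κ]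
    (hE : Nonempty ((ModuleCat.of R (Ideal.span {e}) ⟶ N) ≃ₗ[k] (ι → k)))
    (hD : Nonempty ((ModuleCat.of R (Ideal.span {d}) ⟶ N) ≃ₗ[k] (κ → k))) :
    Module.Finite k (Ext.{v} N N 1) ∧
      Module.finrank k (Ext.{v} N N 1) + Fintype.card ι =
        Fintype.card κ + Module.finrank k (N ⟶ N) ∧
      ∀ i : ℕ, Subsingleton (Ext.{v} N N (i + 2)) := by
  have := projective_span_idempotent he
  have := projective_span_idempotent hd
  obtain ⟨eE⟩ := hE
  obtain ⟨eD⟩ := hD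
  let g₀ := cyclicCover e n₀
  have hg₀ : Function.Surjective g₀ := cyclicCover_surjective hn₀ hgen
  have S₀ := LinearMap.shortExact_shortComplexKer hg₀
  -- Since $t=te$ and $tn_0=0$, the element $t$ lies in the kernel of $Re\to N$; `hexact` says that
  -- it generates this kernel, and $dt=t$ makes $Rd$ a cover of it.
  let t' : LinearMap.ker g₀ := ⟨⟨t, Ideal.mem_span_singleton'.2 ⟨t, hte⟩⟩, htn⟩
  let g₁ := cyclicCover d t'
  have hg₁ : Function.Surjective g₁ := by
    refine cyclicCover_surjective (Subtype.ext (Subtype.ext hdt)) ?_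
    rintro ⟨⟨x, hx⟩, hx'⟩
    obtain ⟨s, hs⟩ := hexact x hx'
    rw [mul_idempotent_of_mem_span he hx] at hs
    exact ⟨s, Subtype.ext (Subtype.ext hs)⟩
  have S₁ := LinearMap.shortExact_shortComplexKer hg₁
  have hK : ∀ x : LinearMap.ker g₁, f • x = x := by
    rintro ⟨⟨x, hx⟩, hx'⟩
    refine Subtype.ext (Subtype.ext ?_)
    have h0 : x * t = 0 := congrArg Subtype.val (congrArg Subtype.val (LinearMap.mem_ker.1 hx'))
    have := hker x h0
    rwa [mul_idempotent_of_mem_span hd hx] at this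
  have hext : ∀ n, Subsingleton (Ext.{v} (ModuleCat.of R (LinearMap.ker g₁)) N n) := fun n =>
    subsingleton_ext_of_idempotent hf hRf N hN n _ hK
  have : Projective g₀.shortComplexKer.X₂ :=
    inferInstanceAs (Projective (ModuleCat.of R (Ideal.span {e})))
  have : Projective g₁.shortComplexKer.X₂ :=
    inferInstanceAs (Projective (ModuleCat.of R (Ideal.span {d})))
  -- Because $\mathrm{Hom}(K,N)=0$, maps to $N$ from the kernel of $Re\to N$ are the same as maps
  -- from $Rd$.
  obtain ⟨e₁⟩ := nonempty_hom_linearEquiv_of_shortExact (k := k) S₁ N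
    ((Ext.homEquiv₀ (X := ModuleCat.of R (LinearMap.ker g₁)) (Y := N)).subsingleton_congr.1
      (hext 0))
  have eK : (g₀.shortComplexKer.X₁ ⟶ N) ≃ₗ[k] (κ → k) := e₁ ≪≫ₗ eD
  have eE' : (g₀.shortComplexKer.X₂ ⟶ N) ≃ₗ[k] (ι → k) := eE
  have := Module.Finite.equiv eK.symm
  have := Module.Finite.equiv eE'.symm
  obtain ⟨h1, h2⟩ := finrank_ext_one_of_shortExact (k := k) S₀ N
  rw [eK.finrank_eq, eE'.finrank_eq, Module.finrank_fintype_fun_eq_card,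
    Module.finrank_fintype_fun_eq_card] at h2
  refine ⟨h1, h2, fun i => ?_⟩
  -- Two shifts lead from $\mathrm{Ext}^{i+2}(N,N)$ back to $\mathrm{Ext}^i(K,N)=0$.
  exact subsingleton_ext_succ_of_shortExact S₀ N (i + 1)
    (subsingleton_ext_succ_of_shortExact S₁ N i (hext i))

end Idempotents

/-! ### Coefficients of paths in products. -/

namespace Quiver.Path

variable {Q : Type u} [Quiver.{v} Q]

/-- A path determines its first arrow. Paths are built from the other end, so this is an induction
on the tail, with lengths excluding the mixed cases. -/
theorem toPath_comp_inj {x y y' : Q} {α : x ⟶ y} {β : x ⟶ y'} :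
    ∀ {z : Q} {p : Path y z} {q : Path y' z}, α.toPath.comp p = β.toPath.comp q →
      (⟨y, α, p⟩ : Σ y : Q, (_ : x ⟶ y) × Path y z) = ⟨y', β, q⟩ := by
  intro z p
  induction p with
  | nil =>
    intro q h
    cases q with
    | nil => cases h; rfl
    | cons q e =>
      have := congrArg length h
      simp at this
  | cons p e ih =>
    intro q h
    cases q with
    | nil =>
      have := congrArg length h
      simp at this
    | cons q e' =>
      rw [comp_cons, comp_cons] at h
      obtain rfl := obj_eq_of_cons_eq_cons h
      obtain rfl := eq_of_heq (hom_heq_of_cons_eq_cons h)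
      have := ih (eq_of_heq (heq_of_cons_eq_cons h))
      cases this
      rfl

end Quiver.Path

namespace PathAlgebra

variable {k : Type w} [Field k] {Q : Type u} [Quiver.{v} Q]

theorem repr_ofPath {x y : Q} (p : Quiver.Path x y) :
    (pathBasis k Q).repr (ofPath k p) = Finsupp.single ⟨x, y, p⟩ 1 :=
  (pathBasis k Q).repr_self _

/-- The coefficient of a path in an element of the path algebra. -/
noncomputable def coeff {x y : Q} (p : Quiver.Path x y) : PathAlgebra k Q →ₗ[k] k :=
  (pathBasis k Q).coord ⟨x, y, p⟩

theorem coeff_self {x y : Q} (p : Quiver.Path x y) : coeff p (ofPath k p) = 1 := by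
  simp [coeff, repr_ofPath]

theorem coeff_ofPath_of_ne {x y x' y' : Q} {p : Quiver.Path x y} {q : Quiver.Path x' y'}
    (h : (⟨x', y', q⟩ : QPath Q) ≠ ⟨x, y, p⟩) : coeff p (ofPath k q) = 0 := by
  simp [coeff, repr_ofPath, h]

/-- Two linear maps which agree on the paths are equal. -/
theorem linearMap_ext {M : Type*} [AddCommGroup M] [Module k M] {f g : PathAlgebra k Q →ₗ[k] M}
    (h : ∀ {x y : Q} (p : Quiver.Path x y), f (ofPath k p) = g (ofPath k p)) : f = g :=
  (pathBasis k Q).ext fun ⟨_, _, p⟩ => h p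

/-- Right multiplication as a linear map. -/
noncomputable def mulRightMap (b : PathAlgebra k Q) : PathAlgebra k Q →ₗ[k] PathAlgebra k Q :=
  mulMap.flip b

/-- Appending or prepending a fixed arrow is injective on paths, so multiplication by an arrow
merely shifts coefficients. This lemma and its four companions below are what is needed to read off
the coefficients of $rt$. -/
theorem coeff_cons_mul {x y z : Q} (p : Quiver.Path x y) (β : y ⟶ z) (a : PathAlgebra k Q) :
    coeff (p.cons β) (a * ofPath k β.toPath) = coeff p a := by
  suffices h : coeff (p.cons β) ∘ₗ mulRightMap (ofPath k β.toPath) = coeff (k := k) p from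
    LinearMap.congr_fun h a
  refine linearMap_ext fun {u v} q => ?_
  change coeff (p.cons β) (ofPath k q * ofPath k β.toPath) = _
  by_cases h : v = y
  · subst h
    rw [ofPath_mul_ofPath, Quiver.Path.comp_toPath_eq_cons]
    by_cases hq : (⟨u, v, q⟩ : QPath Q) = ⟨x, v, p⟩
    · cases hq
      rw [coeff_self, coeff_self]
    · rw [coeff_ofPath_of_ne hq, coeff_ofPath_of_ne]
      intro h'
      cases h'
      exact hq rfl
  · rw [ofPath_mul_ofPath_of_ne h, map_zero, coeff_ofPath_of_ne]
    intro h'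
    cases h'
    exact h rfl

theorem coeff_cons_mul_of_ne {x y z y' z' : Q} (p : Quiver.Path x y) (β : y ⟶ z) (γ : y' ⟶ z')
    (hne : (⟨y', z', γ⟩ : Σ x : Q, Σ y : Q, (x ⟶ y)) ≠ ⟨y, z, β⟩) (a : PathAlgebra k Q) :
    coeff (p.cons β) (a * ofPath k γ.toPath) = 0 := by
  suffices h : coeff (p.cons β) ∘ₗ mulRightMap (ofPath k γ.toPath) = 0 from
    LinearMap.congr_fun h a
  refine linearMap_ext fun {u v} q => ?_
  change coeff (p.cons β) (ofPath k q * ofPath k γ.toPath) = 0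
  by_cases h : v = y'
  · subst h
    rw [ofPath_mul_ofPath, Quiver.Path.comp_toPath_eq_cons, coeff_ofPath_of_ne]
    intro h'
    cases h'
    exact hne rfl
  · rw [ofPath_mul_ofPath_of_ne h, map_zero]

theorem coeff_nil_mul {x y' z' : Q} (γ : y' ⟶ z') (a : PathAlgebra k Q) :
    coeff (Quiver.Path.nil : Quiver.Path x x) (a * ofPath k γ.toPath) = 0 := by
  suffices h : coeff (Quiver.Path.nil : Quiver.Path x x) ∘ₗ mulRightMap (ofPath k γ.toPath) = 0
    from LinearMap.congr_fun h a
  refine linearMap_ext fun {u v} q => ?_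
  change coeff _ (ofPath k q * ofPath k γ.toPath) = 0
  by_cases h : v = y'
  · subst h
    rw [ofPath_mul_ofPath, Quiver.Path.comp_toPath_eq_cons, coeff_ofPath_of_ne]
    intro h'
    cases h'
  · rw [ofPath_mul_ofPath_of_ne h, map_zero]

theorem coeff_comp_mul {x y z : Q} (α : x ⟶ y) (q : Quiver.Path y z) (a : PathAlgebra k Q) :
    coeff (α.toPath.comp q) (ofPath k α.toPath * a) = coeff q a := by
  suffices h : coeff (α.toPath.comp q) ∘ₗ mulMap (ofPath k α.toPath) = coeff (k := k) q from
    LinearMap.congr_fun h a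
  refine linearMap_ext fun {u v} p => ?_
  change coeff _ (ofPath k α.toPath * ofPath k p) = _
  by_cases h : y = u
  · subst h
    rw [ofPath_mul_ofPath]
    by_cases hq : (⟨y, v, p⟩ : QPath Q) = ⟨y, z, q⟩
    · cases hq
      rw [coeff_self, coeff_self]
    · rw [coeff_ofPath_of_ne hq, coeff_ofPath_of_ne]
      intro h'
      obtain rfl : v = z := congrArg (fun r : QPath Q => r.2.1) h'
      have h'' : α.toPath.comp p = α.toPath.comp q := by simpa using h'
      rw [Quiver.Path.comp_inj_right] at h''
      exact hq (by rw [h''])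
  · rw [ofPath_mul_ofPath_of_ne h, map_zero, coeff_ofPath_of_ne]
    intro h'
    cases h'
    exact h rfl

theorem coeff_comp_mul_of_ne {x y z x' y' : Q} (α : x ⟶ y) (q : Quiver.Path y z) (γ : x' ⟶ y')
    (hne : (⟨x', y', γ⟩ : Σ x : Q, Σ y : Q, (x ⟶ y)) ≠ ⟨x, y, α⟩) (a : PathAlgebra k Q) :
    coeff (α.toPath.comp q) (ofPath k γ.toPath * a) = 0 := by
  suffices h : coeff (α.toPath.comp q) ∘ₗ mulMap (ofPath k γ.toPath) = 0 from
    LinearMap.congr_fun h a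
  refine linearMap_ext fun {u v} p => ?_
  change coeff _ (ofPath k γ.toPath * ofPath k p) = 0
  by_cases h : y' = u
  · subst h
    rw [ofPath_mul_ofPath, coeff_ofPath_of_ne]
    intro h'
    obtain rfl : x' = x := congrArg (fun r : QPath Q => r.1) h'
    obtain rfl : v = z := congrArg (fun r : QPath Q => r.2.1) h'
    have h'' : γ.toPath.comp p = α.toPath.comp q := by simpa using h'
    cases Quiver.Path.toPath_comp_inj h''
    exact hne rfl
  · rw [ofPath_mul_ofPath_of_ne h, map_zero]

variable [Fintype Q]

/-- If a set `T` of paths is stable under composition with paths on both sides, its linear span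
contains the two-sided ideals generated by its subsets. -/
theorem mem_span_paths_of_mem_twoSidedIdeal_span {S : Set (PathAlgebra k Q)} {T : Set (QPath Q)}
    (hS : S ⊆ Submodule.span k (pathBasis k Q '' T))
    (hl : ∀ {x y z : Q} (p : Quiver.Path x y) (q : Quiver.Path y z),
      (⟨y, z, q⟩ : QPath Q) ∈ T → (⟨x, z, p.comp q⟩ : QPath Q) ∈ T)
    (hr : ∀ {x y z : Q} (p : Quiver.Path x y) (q : Quiver.Path y z),
      (⟨x, y, p⟩ : QPath Q) ∈ T → (⟨x, z, p.comp q⟩ : QPath Q) ∈ T)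
    {a : PathAlgebra k Q} (ha : a ∈ TwoSidedIdeal.span S) :
    a ∈ Submodule.span k (pathBasis k Q '' T) := by
  set V := Submodule.span k (pathBasis k Q '' T) with hV
  have hl' : ∀ (b c : PathAlgebra k Q), c ∈ V → b * c ∈ V := by
    intro b c hc
    induction b using path_induction with
    | h0 => rw [zero_mul]; exact V.zero_mem
    | hadd b b' hb hb' => rw [add_mul]; exact V.add_mem hb hb'
    | @hsmul r x y p =>
      rw [smul_mul_assoc]
      refine V.smul_mem _ ?_
      induction hc using Submodule.span_induction with
      | mem c hc =>
        obtain ⟨⟨x', y', q⟩, hq, rfl⟩ := hc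
        by_cases h : y = x'
        · subst h
          have := ofPath_mul_ofPath (k := k) p q
          rw [ofPath, ofPath] at this
          rw [ofPath, this]
          exact Submodule.subset_span ⟨_, hl p q hq, rfl⟩
        · have := ofPath_mul_ofPath_of_ne (k := k) h p q
          rw [ofPath, ofPath] at this
          rw [ofPath, this]
          exact V.zero_mem
      | zero => rw [mul_zero]; exact V.zero_mem
      | add c c' _ _ hc hc' => rw [mul_add]; exact V.add_mem hc hc'
      | smul s c _ hc => rw [mul_smul_comm]; exact V.smul_mem _ hc
  have hr' : ∀ (b c : PathAlgebra k Q), c ∈ V → c * b ∈ V := by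
    intro b c hc
    induction b using path_induction with
    | h0 => rw [mul_zero]; exact V.zero_mem
    | hadd b b' hb hb' => rw [mul_add]; exact V.add_mem hb hb'
    | @hsmul r x y p =>
      rw [mul_smul_comm]
      refine V.smul_mem _ ?_
      induction hc using Submodule.span_induction with
      | mem c hc =>
        obtain ⟨⟨x', y', q⟩, hq, rfl⟩ := hc
        by_cases h : y' = x
        · subst h
          have := ofPath_mul_ofPath (k := k) q p
          rw [ofPath, ofPath] at this
          rw [ofPath, this]
          exact Submodule.subset_span ⟨_, hr q p hq, rfl⟩
        · have := ofPath_mul_ofPath_of_ne (k := k) h q p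
          rw [ofPath, ofPath] at this
          rw [ofPath, this]
          exact V.zero_mem
      | zero => rw [zero_mul]; exact V.zero_mem
      | add c c' _ _ hc hc' => rw [add_mul]; exact V.add_mem hc hc'
      | smul s c _ hc => rw [smul_mul_assoc]; exact V.smul_mem _ hc
  let J : TwoSidedIdeal (PathAlgebra k Q) := TwoSidedIdeal.mk' (V : Set (PathAlgebra k Q))
    V.zero_mem V.add_mem V.neg_mem (fun {b c} hc => hl' b c hc) (fun {c b} hc => hr' b c hc)
  have hJ : TwoSidedIdeal.span S ≤ J := TwoSidedIdeal.span_le.2 fun s hs =>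
    (TwoSidedIdeal.mem_mk' _ _ _ _ _ _ _).2 (hS hs)
  exact (TwoSidedIdeal.mem_mk' _ _ _ _ _ _ _).1 (hJ ha)

theorem coeff_eq_zero_of_mem_span {T : Set (QPath Q)} {a : PathAlgebra k Q}
    (ha : a ∈ Submodule.span k (pathBasis k Q '' T)) {x y : Q} {p : Quiver.Path x y}
    (hp : (⟨x, y, p⟩ : QPath Q) ∉ T) : coeff p a = 0 := by
  by_contra h
  exact hp ((pathBasis k Q).mem_span_image.1 ha (Finsupp.mem_support_iff.2 h))

end PathAlgebra

/-! ### Paths inside and outside the ideal. -/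

namespace BoundQuiver

open PathAlgebra

variable {k : Type w} [Field k] {Q : Type u} [Quiver.{v} Q] [Fintype Q]

/-- The span of the paths in $I$ is stable under multiplication by paths and contains the
generators, so it is all of $I$. -/
theorem ofPath_mem_of_coeff_ne_zero {I : Ideal (PathAlgebra k Q)} [I.IsTwoSided]
    (hmon : IsMonomial I) {a : PathAlgebra k Q} (ha : a ∈ I) {x y : Q} {p : Quiver.Path x y}
    (hp : coeff p a ≠ 0) : ofPath k p ∈ I := by
  by_contra hpI
  refine hp (coeff_eq_zero_of_mem_span (T := {q | pathBasis k Q q ∈ I}) ?_ hpI)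
  obtain ⟨S, hS⟩ := hmon
  rw [hS, TwoSidedIdeal.mem_asIdeal] at ha
  refine mem_span_paths_of_mem_twoSidedIdeal_span ?_ ?_ ?_ ha
  · rintro _ ⟨q, hq, rfl⟩
    refine Submodule.subset_span ⟨q, ?_, rfl⟩
    rw [Set.mem_ofPred_eq, hS, TwoSidedIdeal.mem_asIdeal]
    exact TwoSidedIdeal.subset_span ⟨q, hq, rfl⟩
  · intro x y z p q hq
    change ofPath k (p.comp q) ∈ I
    rw [← ofPath_mul_ofPath]
    exact I.mul_mem_left _ hq
  · intro x y z p q hp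
    change ofPath k (p.comp q) ∈ I
    rw [← ofPath_mul_ofPath]
    exact I.mul_mem_right _ hp

/-- $F$ is spanned by paths of length at least 1, so elements of $F^2\supseteq I$ only involve paths
of length at least 2. Thus vertices and arrows survive in $A$. -/
theorem two_le_length_of_mem {I : Ideal (PathAlgebra k Q)} (hadm : IsAdmissible I) {x y : Q}
    {p : Quiver.Path x y} (hp : ofPath k p ∈ I) : 2 ≤ p.length := by
  obtain ⟨m, -, -, hI⟩ := hadm
  have hF : ∀ a ∈ arrowIdeal k Q, a ∈ Submodule.span k
      (pathBasis k Q '' {q | 1 ≤ q.2.2.length}) := by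
    intro a ha
    rw [arrowIdeal, TwoSidedIdeal.mem_asIdeal] at ha
    refine mem_span_paths_of_mem_twoSidedIdeal_span ?_ ?_ ?_ ha
    · rintro _ ⟨x, y, α, rfl⟩
      exact Submodule.subset_span ⟨⟨x, y, α.toPath⟩, Nat.le_refl 1, rfl⟩
    · intro x y z p q (hq : 1 ≤ q.length)
      change 1 ≤ (p.comp q).length
      rw [Quiver.Path.length_comp]
      omega
    · intro x y z p q (hp : 1 ≤ p.length)
      change 1 ≤ (p.comp q).length
      rw [Quiver.Path.length_comp]
      omega
  have hF2 : ∀ a ∈ arrowIdeal k Q ^ 2, a ∈ Submodule.span k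
      (pathBasis k Q '' {q | 2 ≤ q.2.2.length}) := by
    intro a ha
    rw [Submodule.pow_succ, Submodule.pow_one] at ha
    induction ha using Submodule.mul_induction_on' with
    | mem_mul_mem b hb c hc =>
      replace hb := hF b hb
      replace hc := hF c hc
      induction hb using Submodule.span_induction with
      | zero => rw [zero_mul]; exact Submodule.zero_mem _
      | add b b' _ _ hb hb' => rw [add_mul]; exact Submodule.add_mem _ hb hb'
      | smul s b _ hb => rw [smul_mul_assoc]; exact Submodule.smul_mem _ _ hb
      | mem b hb =>
        obtain ⟨⟨x, y, p⟩, hp, rfl⟩ := hb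
        induction hc using Submodule.span_induction with
        | zero => rw [mul_zero]; exact Submodule.zero_mem _
        | add c c' _ _ hc hc' => rw [mul_add]; exact Submodule.add_mem _ hc hc'
        | smul s c _ hc => rw [mul_smul_comm]; exact Submodule.smul_mem _ _ hc
        | mem c hc =>
          obtain ⟨⟨x', y', q⟩, hq, rfl⟩ := hc
          change ofPath k p * ofPath k q ∈ _
          by_cases h : y = x'
          · subst h
            rw [ofPath_mul_ofPath]
            refine Submodule.subset_span ⟨⟨x, y', p.comp q⟩, ?_, rfl⟩
            change 2 ≤ (p.comp q).length
            change 1 ≤ p.length at hp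
            change 1 ≤ q.length at hq
            rw [Quiver.Path.length_comp]
            omega
          · rw [ofPath_mul_ofPath_of_ne h]
            exact Submodule.zero_mem _
    | add a _ b _ ha hb => exact Submodule.add_mem _ ha hb
  by_contra hlen
  have := coeff_eq_zero_of_mem_span (p := p) (hF2 _ (hI hp)) hlen
  rw [coeff_self] at this
  exact one_ne_zero this

/-- The schurian condition makes parallel paths proportional in $A$, monomiality turns such a
relation into membership of a path in $I$, and semi-commutativity transfers that membership to $p$.
-/
theorem path_unique {I : Ideal (PathAlgebra k Q)} [I.IsTwoSided] (hmon : IsMonomial I)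
    (hsemi : IsSemicommutative I) (hschur : IsSchurian I)
    {x y : Q} {p : Quiver.Path x y} (hp : ofPath k p ∉ I) (q : Quiver.Path x y) : q = p := by
  by_contra hne
  have hmem : ∀ r : Quiver.Path x y, Ideal.Quotient.mk I (ofPath k r) ∈ peirce I x y := by
    intro r
    refine ⟨Ideal.Quotient.mk I (ofPath k r), ?_⟩
    rw [LinearMap.mulLeftRight_apply, ← map_mul, ← map_mul, vertex, vertex, ofPath_mul_ofPath,
      ofPath_mul_ofPath, Quiver.Path.nil_comp, Quiver.Path.comp_nil]
  obtain ⟨v, hv⟩ := rank_le_one_iff.1 (hschur x y)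
  obtain ⟨r, hr⟩ := hv ⟨_, hmem p⟩
  obtain ⟨s, hs⟩ := hv ⟨_, hmem q⟩
  replace hr : r • (v : PathAlgebra k Q ⧸ I) = Ideal.Quotient.mk I (ofPath k p) :=
    congrArg Subtype.val hr
  replace hs : s • (v : PathAlgebra k Q ⧸ I) = Ideal.Quotient.mk I (ofPath k q) :=
    congrArg Subtype.val hs
  -- In $A$ one has $p=rv$ and $q=sv$ with $v$ a generator of $e_xAe_y$; moreover $r\ne 0$ because
  -- $p\notin I$.
  have hI : r • ofPath k q - s • ofPath k p ∈ I := by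
    rw [← Ideal.Quotient.eq_zero_iff_mem]
    change r • Ideal.Quotient.mk I (ofPath k q) - s • Ideal.Quotient.mk I (ofPath k p) = 0
    rw [← hr, ← hs, smul_comm, sub_self]
  have hr0 : r ≠ 0 := by
    rintro rfl
    rw [zero_smul] at hr
    exact hp (Ideal.Quotient.eq_zero_iff_mem.1 hr.symm)
  have hq : ofPath k q ∈ I := by
    refine ofPath_mem_of_coeff_ne_zero hmon hI ?_
    rw [map_sub, map_smul, map_smul, coeff_self, coeff_ofPath_of_ne]
    · simpa using hr0
    · intro h
      exact hne (by simpa using h.symm)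
  exact hp ((hsemi p q).2 hq)

/-! ### Quotients of the path algebra with kernel spanned by paths. -/

variable {A : Type t} [Ring A] [Algebra k A] {φ : PathAlgebra k Q →ₐ[k] A}

/-- The image of a path under a morphism of algebras `kQ → A`. -/
noncomputable def pathClass (φ : PathAlgebra k Q →ₐ[k] A) {x y : Q} (p : Quiver.Path x y) : A :=
  φ (ofPath k p)

/-- The kernel of `φ` is spanned by paths. -/
def HasMonomialKernel (φ : PathAlgebra k Q →ₐ[k] A) : Prop :=
  ∀ ⦃a : PathAlgebra k Q⦄, φ a = 0 → ∀ ⦃x y : Q⦄ (p : Quiver.Path x y), coeff p a ≠ 0 →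
    pathClass φ p = 0

theorem pathClass_mul {x y z : Q} (p : Quiver.Path x y) (q : Quiver.Path y z) :
    pathClass φ p * pathClass φ q = pathClass φ (p.comp q) := by
  rw [pathClass, pathClass, ← map_mul, ofPath_mul_ofPath, pathClass]

theorem pathClass_mul_of_ne {x y y' z : Q} (h : y ≠ y') (p : Quiver.Path x y)
    (q : Quiver.Path y' z) : pathClass φ p * pathClass φ q = 0 := by
  rw [pathClass, pathClass, ← map_mul, ofPath_mul_ofPath_of_ne h, map_zero]

theorem one_eq_sum_pathClass (φ : PathAlgebra k Q →ₐ[k] A) :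
    (1 : A) = ∑ x : Q, pathClass φ (Quiver.Path.nil : Quiver.Path x x) := by
  rw [← map_one φ, one_def, map_sum]
  rfl

theorem pathClass_induction (hφ : Function.Surjective φ) {P : A → Prop} (a : A)
    (h0 : P 0) (hadd : ∀ a b, P a → P b → P (a + b)) (hsmul : ∀ (c : k) a, P a → P (c • a))
    (hpath : ∀ {x y : Q} (p : Quiver.Path x y), P (pathClass φ p)) : P a := by
  obtain ⟨a, rfl⟩ := hφ a
  induction a using path_induction with
  | h0 => rwa [map_zero]
  | hadd a b ha hb => rw [map_add]; exact hadd _ _ ha hb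
  | hsmul c p => rw [map_smul]; exact hsmul c _ (hpath p)

/-- If the kernel of `kQ → A` is spanned by paths, the classes of the other paths form a basis
of `A`. -/
noncomputable def pathClassBasis (hφ : Function.Surjective φ) (hmon : HasMonomialKernel φ) :
    Module.Basis {p : QPath Q // pathClass φ p.2.2 ≠ 0} k A :=
  Module.Basis.mk (v := fun p => pathClass φ p.1.2.2)
    (by
      rw [linearIndependent_iff']
      intro s g hg ⟨⟨x, y, p⟩, hp⟩ hps
      by_contra hne
      have hI : φ (∑ i ∈ s, g i • ofPath k i.1.2.2) = 0 := by
        rw [map_sum]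
        exact (Finset.sum_congr rfl fun i _ => map_smul φ _ _).trans hg
      refine hp (hmon hI p ?_)
      rw [map_sum, Finset.sum_eq_single_of_mem _ hps]
      · rw [map_smul, coeff_self]
        simpa using hne
      · rintro ⟨⟨x', y', q⟩, hq⟩ _ hqp
        rw [map_smul, coeff_ofPath_of_ne, smul_zero]
        intro h
        exact hqp (Subtype.ext h))
    (by
      rintro a -
      induction a using pathClass_induction hφ with
      | h0 => exact Submodule.zero_mem _
      | hadd a b ha hb => exact Submodule.add_mem _ ha hb
      | hsmul c a ha => exact Submodule.smul_mem _ c ha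
      | @hpath x y p =>
        by_cases hp : pathClass φ p = 0
        · rw [hp]
          exact Submodule.zero_mem _
        · exact Submodule.subset_span ⟨⟨⟨x, y, p⟩, hp⟩, rfl⟩)

theorem pathClassBasis_apply (hφ : Function.Surjective φ) (hmon : HasMonomialKernel φ)
    (p : {p : QPath Q // pathClass φ p.2.2 ≠ 0}) :
    pathClassBasis hφ hmon p = pathClass φ p.1.2.2 := by
  rw [pathClassBasis, Module.Basis.mk_apply]

theorem pathClassBasis_repr (hφ : Function.Surjective φ) (hmon : HasMonomialKernel φ)
    (p : {p : QPath Q // pathClass φ p.2.2 ≠ 0}) (a : PathAlgebra k Q) :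
    (pathClassBasis hφ hmon).repr (φ a) p = coeff p.1.2.2 a := by
  induction a using path_induction with
  | h0 => simp
  | hadd a b ha hb => rw [map_add, map_add, map_add, Finsupp.add_apply, ha, hb]
  | @hsmul c x y q =>
    rw [map_smul, map_smul, map_smul, Finsupp.smul_apply]
    congr 1
    change (pathClassBasis hφ hmon).repr (pathClass φ q) p = _
    by_cases hq : pathClass φ q = 0
    · rw [hq, map_zero, coeff_ofPath_of_ne, Finsupp.zero_apply]
      rintro h
      apply p.2
      have h' : (⟨x, y, q⟩ : QPath Q) = p.1 := h
      rw [← h']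
      exact hq
    · have := pathClassBasis_apply hφ hmon ⟨⟨x, y, q⟩, hq⟩
      dsimp only at this
      rw [← this, Module.Basis.repr_self]
      by_cases h : (⟨⟨x, y, q⟩, hq⟩ : {p : QPath Q // pathClass φ p.2.2 ≠ 0}) = p
      · subst h
        rw [Finsupp.single_eq_same, coeff_self]
      · rw [Finsupp.single_eq_of_ne' h, coeff_ofPath_of_ne]
        intro h'
        exact h (Subtype.ext h')

end BoundQuiver

/-! ### The algebra as a module over its enveloping algebra. -/

section Bimodule

variable (k : Type w) [Field k] (A : Type u) [Ring A] [Algebra k A]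

/-- The identity of `A`, as a map to the bimodule `A`. -/
noncomputable def toBimodule : A ≃+ envelopingBimodule k A :=
  AddEquiv.refl A

variable {A}

theorem tmul_smul_toBimodule (a b m : A) :
    (a ⊗ₜ[k] MulOpposite.op b) • toBimodule k A m = toBimodule k A (a * (m * b)) :=
  rfl

theorem algebraMap_smul_toBimodule (c : k) (m : A) :
    algebraMap k (A ⊗[k] Aᵐᵒᵖ) c • toBimodule k A m = toBimodule k A (c • m) := by
  rw [Algebra.TensorProduct.algebraMap_apply, ← MulOpposite.op_one, tmul_smul_toBimodule,
    mul_one, Algebra.smul_def]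

/-- If the left ideal `J` contains `(a ⊗ 1 - 1 ⊗ a) e` for all `a`, it contains `r e` for all `r`
annihilating `1`. -/
theorem mul_mem_of_smul_one_eq_zero {J : Ideal (A ⊗[k] Aᵐᵒᵖ)} {e : A ⊗[k] Aᵐᵒᵖ}
    (hJ : ∀ a : A, (a ⊗ₜ[k] (1 : Aᵐᵒᵖ)) * e - (1 ⊗ₜ[k] MulOpposite.op a) * e ∈ J)
    (r : A ⊗[k] Aᵐᵒᵖ) (hr : r • toBimodule k A 1 = 0) : r * e ∈ J := by
  suffices h : ∀ r : A ⊗[k] Aᵐᵒᵖ, r * e - (1 ⊗ₜ[k] MulOpposite.op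
      ((toBimodule k A).symm (r • toBimodule k A 1))) * e ∈ J by
    have := h r
    rwa [hr, map_zero, MulOpposite.op_zero, tmul_zero, zero_mul, sub_zero] at this
  clear hr r
  intro r
  induction r using TensorProduct.induction_on with
  | zero =>
    have h : (0 : A ⊗[k] Aᵐᵒᵖ) • toBimodule k A 1 = 0 := by
      have := sub_smul (0 : A ⊗[k] Aᵐᵒᵖ) 0 (toBimodule k A 1)
      rwa [sub_self, sub_self] at this
    rw [h, map_zero, MulOpposite.op_zero, tmul_zero, sub_self]
    exact Ideal.zero_mem _
  | add r s hr hs =>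
    rw [add_smul, map_add, MulOpposite.op_add, tmul_add, add_mul, add_mul, add_sub_add_comm]
    exact Ideal.add_mem _ hr hs
  | tmul a b =>
    induction b using MulOpposite.rec' with
    | h b =>
      -- $(a\otimes b)e-(1\otimes ab)e=(1\otimes b)\bigl((a\otimes 1)e-(1\otimes a)e\bigr)$, the
      -- second factor being multiplied in the opposite algebra.
      have := Ideal.mul_mem_left J (1 ⊗ₜ[k] MulOpposite.op b) (hJ a)
      rw [mul_sub, ← mul_assoc, ← mul_assoc, Algebra.TensorProduct.tmul_mul_tmul,
        Algebra.TensorProduct.tmul_mul_tmul, one_mul, mul_one, one_mul,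
        ← MulOpposite.op_mul] at this
      rwa [tmul_smul_toBimodule, AddEquiv.symm_apply_apply, one_mul]

end Bimodule

/-! ### Idempotents of the enveloping algebra and exactness at $Re$. -/

namespace BoundQuiver

section Pairs

/-- The pairs `(x, x)`. -/
def diagonalPairs (Q : Type u) [Fintype Q] [DecidableEq Q] : Finset (Q × Q) :=
  Finset.univ.image fun x => (x, x)

theorem mem_diagonalPairs {Q : Type u} [Fintype Q] [DecidableEq Q] {x y : Q} :
    (x, y) ∈ diagonalPairs Q ↔ x = y := by
  simp [diagonalPairs]

variable {Q : Type u} [Quiver.{v} Q] [DecidableEq Q] [Fintype (Σ x : Q, Σ y : Q, (x ⟶ y))]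

variable (Q) in
/-- The pairs of vertices joined by an arrow. -/
def arrowPairs : Finset (Q × Q) :=
  Finset.univ.image fun α : Σ x : Q, Σ y : Q, (x ⟶ y) => (α.1, α.2.1)

theorem mem_arrowPairs {x y : Q} : (x, y) ∈ arrowPairs Q ↔ Nonempty (x ⟶ y) := by
  rw [arrowPairs, Finset.mem_image]
  constructor
  · rintro ⟨⟨x', y', α⟩, -, h⟩
    cases h
    exact ⟨α⟩
  · rintro ⟨α⟩
    exact ⟨⟨x, y, α⟩, Finset.mem_univ _, rfl⟩

end Pairs

open PathAlgebra

variable {k : Type w} [Field k] {Q : Type u} [Quiver.{v} Q] [Fintype Q]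
variable {A : Type t} [Ring A] [Algebra k A] {φ : PathAlgebra k Q →ₐ[k] A}

/-- The element `p ⊗ q` of the enveloping algebra of `A`. -/
noncomputable def bipath (φ : PathAlgebra k Q →ₐ[k] A) {a b c d : Q}
    (p : Quiver.Path a b) (q : Quiver.Path c d) :
    A ⊗[k] Aᵐᵒᵖ :=
  pathClass φ p ⊗ₜ MulOpposite.op (pathClass φ q)

theorem bipath_induction (hφ : Function.Surjective φ) {P : A ⊗[k] Aᵐᵒᵖ → Prop}
    (r : A ⊗[k] Aᵐᵒᵖ)
    (h0 : P 0) (hadd : ∀ r s, P r → P s → P (r + s)) (hsmul : ∀ (c : k) r, P r → P (c • r))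
    (hpath : ∀ {a b c d : Q} (p : Quiver.Path a b) (q : Quiver.Path c d), P (bipath φ p q)) :
    P r := by
  induction r using TensorProduct.induction_on with
  | zero => exact h0
  | add r s hr hs => exact hadd r s hr hs
  | tmul a b =>
    induction b using MulOpposite.rec' with
    | h b =>
      induction a using pathClass_induction hφ with
      | h0 => rwa [zero_tmul]
      | hadd a a' ha ha' => rw [add_tmul]; exact hadd _ _ ha ha'
      | hsmul c a ha => rw [← smul_tmul']; exact hsmul c _ ha
      | hpath p =>
        induction b using pathClass_induction hφ with
        | h0 => rwa [MulOpposite.op_zero, tmul_zero]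
        | hadd b b' hb hb' => rw [MulOpposite.op_add, tmul_add]; exact hadd _ _ hb hb'
        | hsmul c b hb => rw [MulOpposite.op_smul, tmul_smul]; exact hsmul c _ hb
        | hpath q => exact hpath p q

theorem bipath_mul {a b c a' b' c' : Q} (p : Quiver.Path a b) (p' : Quiver.Path b c)
    (q : Quiver.Path b' c') (q' : Quiver.Path a' b') :
    bipath φ p q * bipath φ p' q' = bipath φ (p.comp p') (q'.comp q) := by
  rw [bipath, bipath, Algebra.TensorProduct.tmul_mul_tmul, ← MulOpposite.op_mul, pathClass_mul,
    pathClass_mul, bipath]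

theorem bipath_mul_of_ne {a b c d a' b' c' d' : Q} (h : (b, c) ≠ (a', d'))
    (p : Quiver.Path a b) (p' : Quiver.Path a' b') (q : Quiver.Path c d)
    (q' : Quiver.Path c' d') : bipath φ p q * bipath φ p' q' = 0 := by
  rw [bipath, bipath, Algebra.TensorProduct.tmul_mul_tmul, ← MulOpposite.op_mul]
  by_cases hb : b = a'
  · have hc : d' ≠ c := fun hc => h (by rw [hb, hc])
    rw [pathClass_mul_of_ne hc, MulOpposite.op_zero, tmul_zero]
  · rw [pathClass_mul_of_ne hb, zero_tmul]

/-- The idempotent `∑ e_x ⊗ e_y` of the enveloping algebra, the sum being over the pairs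
`(x, y)` in `T`. -/
noncomputable def pairIdem (φ : PathAlgebra k Q →ₐ[k] A) (T : Finset (Q × Q)) :
    A ⊗[k] Aᵐᵒᵖ :=
  ∑ x ∈ T, bipath φ (Quiver.Path.nil : Quiver.Path x.1 x.1)
    (Quiver.Path.nil : Quiver.Path x.2 x.2)

section ArrowDiff

variable [Fintype (Σ x : Q, Σ y : Q, (x ⟶ y))]

/-- The element `∑ (α ⊗ e_y - e_x ⊗ α)`, the sum being over the arrows `α : x ⟶ y`. -/
noncomputable def arrowDiff (φ : PathAlgebra k Q →ₐ[k] A) :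
    A ⊗[k] Aᵐᵒᵖ :=
  ∑ α : Σ x : Q, Σ y : Q, (x ⟶ y),
    (bipath φ α.2.2.toPath (Quiver.Path.nil : Quiver.Path α.2.1 α.2.1) -
      bipath φ (Quiver.Path.nil : Quiver.Path α.1 α.1) α.2.2.toPath)

theorem arrowDiff_smul_one :
    arrowDiff φ • toBimodule k A 1 = 0 := by
  rw [arrowDiff, Finset.sum_smul]
  refine Finset.sum_eq_zero fun α _ => ?_
  rw [sub_smul, bipath, bipath, tmul_smul_toBimodule, tmul_smul_toBimodule, one_mul, one_mul,
    pathClass_mul, pathClass_mul, Quiver.Path.nil_comp, Quiver.Path.comp_nil, sub_self]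

end ArrowDiff

variable [DecidableEq Q]

/-- As the second factor multiplies in reverse, left multiplication tests the outer endpoints
(source of $p$, target of $q$), whereas right multiplication tests the inner ones. -/
theorem pairIdem_mul_bipath (T : Finset (Q × Q)) {a b c d : Q} (p : Quiver.Path a b)
    (q : Quiver.Path c d) :
    pairIdem φ T * bipath φ p q = if (a, d) ∈ T then bipath φ p q else 0 := by
  rw [pairIdem, Finset.sum_mul, ← Finset.sum_ite_eq' T (a, d) fun _ => bipath φ p q]
  refine Finset.sum_congr rfl ?_
  rintro ⟨x, y⟩ -
  split_ifs with h
  · cases h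
    rw [bipath_mul, Quiver.Path.nil_comp, Quiver.Path.comp_nil]
  · exact bipath_mul_of_ne h _ _ _ _

theorem bipath_mul_pairIdem (T : Finset (Q × Q)) {a b c d : Q} (p : Quiver.Path a b)
    (q : Quiver.Path c d) :
    bipath φ p q * pairIdem φ T = if (b, c) ∈ T then bipath φ p q else 0 := by
  rw [pairIdem, Finset.mul_sum, ← Finset.sum_ite_eq' T (b, c) fun _ => bipath φ p q]
  refine Finset.sum_congr rfl ?_
  rintro ⟨x, y⟩ -
  split_ifs with h
  · cases h
    rw [bipath_mul, Quiver.Path.nil_comp, Quiver.Path.comp_nil]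
  · exact bipath_mul_of_ne (Ne.symm h) _ _ _ _

theorem isIdempotentElem_pairIdem (T : Finset (Q × Q)) : IsIdempotentElem (pairIdem φ T) := by
  rw [IsIdempotentElem]
  nth_rw 2 3 [pairIdem]
  rw [Finset.mul_sum]
  refine Finset.sum_congr rfl fun x hx => ?_
  rw [pairIdem_mul_bipath, if_pos hx]

/-- If `T` is stable under composition with paths on both sides then `f R f = R f`, where `f` is
the idempotent of `T`. -/
theorem pairIdem_mul_mul_pairIdem (hφ : Function.Surjective φ) {T : Finset (Q × Q)}
    (hT : ∀ {a b c d : Q}, Quiver.Path a b → Quiver.Path c d → (b, c) ∈ T → (a, d) ∈ T)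
    (r : A ⊗[k] Aᵐᵒᵖ) :
    pairIdem φ T * (r * pairIdem φ T) = r * pairIdem φ T := by
  induction r using bipath_induction hφ with
  | h0 => rw [zero_mul, mul_zero]
  | hadd r s hr hs => rw [add_mul, mul_add, hr, hs]
  | hsmul c r hr => rw [smul_mul_assoc, mul_smul_comm, hr]
  | hpath p q =>
    rw [bipath_mul_pairIdem]
    split_ifs with h
    · rw [pairIdem_mul_bipath, if_pos (hT p q h)]
    · rw [mul_zero]

theorem pairIdem_smul_pathClass (T : Finset (Q × Q)) {x y : Q} (p : Quiver.Path x y) :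
    pairIdem φ T • toBimodule k A (pathClass φ p) =
      if (x, y) ∈ T then toBimodule k A (pathClass φ p) else 0 := by
  rw [pairIdem, Finset.sum_smul, ← Finset.sum_ite_eq' T (x, y) fun _ => toBimodule k _ _]
  refine Finset.sum_congr rfl ?_
  rintro ⟨x', y'⟩ -
  rw [bipath, tmul_smul_toBimodule]
  split_ifs with h
  · cases h
    rw [pathClass_mul, pathClass_mul, Quiver.Path.nil_comp, Quiver.Path.comp_nil]
  · rw [← map_zero (toBimodule k A)]
    congr 1
    by_cases hy : y = y'
    · subst hy
      rw [pathClass_mul, pathClass_mul_of_ne]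
      rintro rfl
      exact h rfl
    · rw [pathClass_mul_of_ne hy, mul_zero]

/-- Used for $fA=0$: the idempotent keeps exactly the paths with endpoints in $T$, and these have
zero class. -/
theorem pairIdem_smul_eq_zero (hφ : Function.Surjective φ) {T : Finset (Q × Q)}
    (hT : ∀ {x y : Q} (p : Quiver.Path x y), (x, y) ∈ T → pathClass φ p = 0)
    (m : envelopingBimodule k A) : pairIdem φ T • m = 0 := by
  obtain ⟨m, rfl⟩ := (toBimodule k A).surjective m
  induction m using pathClass_induction hφ with
  | h0 => rw [map_zero, smul_zero]
  | hadd a b ha hb => rw [map_add, smul_add, ha, hb, add_zero]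
  | hsmul c a ha =>
    rw [← algebraMap_smul_toBimodule, smul_smul, ← Algebra.commutes, mul_smul, ha, smul_zero]
  | hpath p =>
    rw [pairIdem_smul_pathClass]
    split_ifs with h
    · rw [hT p h, map_zero]
    · rfl

/-- If the `π i` are the paths with non-zero classes whose pairs of endpoints lie in `T`, then their classes
form a basis of the image in `A` of the idempotent of `T`. -/
theorem existsUnique_sum_of_pairIdem_smul (hφ : Function.Surjective φ) (hmon : HasMonomialKernel φ) {T : Finset (Q × Q)}
    {ι : Type*} [Fintype ι] (π : ι → QPath Q) (hπ : Function.Injective π)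
    (hI : ∀ i, pathClass φ (π i).2.2 ≠ 0)
    (hsurj : ∀ {x y : Q} (p : Quiver.Path x y), (x, y) ∈ T → pathClass φ p ≠ 0 →
      ∃ i, π i = ⟨x, y, p⟩)
    (m : envelopingBimodule k A) (hm : pairIdem φ T • m = m) :
    ∃! c : ι → k, ∑ i, algebraMap k (A ⊗[k] Aᵐᵒᵖ) (c i) •
      toBimodule k A (pathClass φ (π i).2.2) = m := by
  classical
  simp only [algebraMap_smul_toBimodule, ← map_sum]
  refine existsUnique_of_exists_of_unique ?_ ?_
  · rw [← hm]
    obtain ⟨m, rfl⟩ := (toBimodule k A).surjective m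
    clear hm
    induction m using pathClass_induction hφ with
    | h0 => exact ⟨0, by simp⟩
    | hadd a b ha hb =>
      obtain ⟨c, hc⟩ := ha
      obtain ⟨d, hd⟩ := hb
      refine ⟨c + d, ?_⟩
      rw [map_add, smul_add, ← hc, ← hd, ← map_add, ← Finset.sum_add_distrib]
      simp only [Pi.add_apply, add_smul]
    | hsmul s a ha =>
      obtain ⟨c, hc⟩ := ha
      refine ⟨s • c, ?_⟩
      rw [← algebraMap_smul_toBimodule, smul_smul, ← Algebra.commutes, mul_smul, ← hc,
        algebraMap_smul_toBimodule, Finset.smul_sum]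
      simp only [Pi.smul_apply, smul_eq_mul, mul_smul]
    | @hpath x y p =>
      rw [pairIdem_smul_pathClass]
      split_ifs with h
      · by_cases hp : pathClass φ p = 0
        · exact ⟨0, by simp [hp]⟩
        · obtain ⟨i, hi⟩ := hsurj p h hp
          refine ⟨Pi.single i 1, ?_⟩
          rw [Finset.sum_eq_single_of_mem i (Finset.mem_univ i)]
          · rw [Pi.single_eq_same, one_smul, hi]
          · intro j _ hj
            rw [Pi.single_eq_of_ne hj, zero_smul]
      · exact ⟨0, by simp⟩
  · intro c d hc hd
    have h := (toBimodule k A).injective (hc.trans hd.symm)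
    let p : ι → {p : QPath Q // pathClass φ p.2.2 ≠ 0} := fun i => ⟨π i, hI i⟩
    have hp : Function.Injective p := fun i j hij => hπ (congrArg Subtype.val hij)
    have hlin := (pathClassBasis hφ hmon).linearIndependent.comp p hp
    have hval : ∀ c : ι → k, ∑ i, c i • pathClass φ (π i).2.2 =
        ∑ i, c i • (pathClassBasis hφ hmon ∘ p) i := fun c =>
      Finset.sum_congr rfl fun i _ => by rw [Function.comp_apply, pathClassBasis_apply]
    rw [hval, hval] at h
    funext i
    have := Fintype.linearIndependent_iff.1 hlin (c - d) (by
      simp only [Pi.sub_apply, sub_smul, Finset.sum_sub_distrib, h, sub_self]) i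
    exact sub_eq_zero.1 this

theorem pairIdem_smul_one : pairIdem φ (diagonalPairs Q) •
    toBimodule k A 1 = toBimodule k A 1 := by
  rw [one_eq_sum_pathClass φ, map_sum, Finset.smul_sum]
  refine Finset.sum_congr rfl fun x _ => ?_
  rw [pairIdem_smul_pathClass, if_pos (mem_diagonalPairs.2 rfl)]

theorem pathClass_tmul_one_mul_pairIdem {x y : Q} (p : Quiver.Path x y) :
    (pathClass φ p ⊗ₜ[k] (1 : Aᵐᵒᵖ)) * pairIdem φ (diagonalPairs Q) =
      bipath φ p (Quiver.Path.nil : Quiver.Path y y) := by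
  rw [← MulOpposite.op_one, one_eq_sum_pathClass φ, Finset.op_sum, tmul_sum, Finset.sum_mul,
    Finset.sum_eq_single_of_mem y (Finset.mem_univ y)]
  · exact (bipath_mul_pairIdem _ _ _).trans (if_pos (mem_diagonalPairs.2 rfl))
  · intro z _ hz
    exact (bipath_mul_pairIdem _ _ _).trans (if_neg fun h => hz (mem_diagonalPairs.1 h).symm)

theorem one_tmul_pathClass_mul_pairIdem {x y : Q} (p : Quiver.Path x y) :
    ((1 : A) ⊗ₜ[k] MulOpposite.op (pathClass φ p)) *
      pairIdem φ (diagonalPairs Q) = bipath φ (Quiver.Path.nil : Quiver.Path x x) p := by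
  rw [one_eq_sum_pathClass φ, sum_tmul, Finset.sum_mul,
    Finset.sum_eq_single_of_mem x (Finset.mem_univ x)]
  · exact (bipath_mul_pairIdem _ _ _).trans (if_pos (mem_diagonalPairs.2 rfl))
  · intro z _ hz
    exact (bipath_mul_pairIdem _ _ _).trans (if_neg fun h => hz (mem_diagonalPairs.1 h))

variable [Fintype (Σ x : Q, Σ y : Q, (x ⟶ y))]

theorem pairIdem_mul_arrowDiff : pairIdem φ (arrowPairs Q) * arrowDiff φ = arrowDiff φ := by
  rw [arrowDiff, Finset.mul_sum]
  refine Finset.sum_congr rfl fun α _ => ?_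
  have h := mem_arrowPairs.2 ⟨α.2.2⟩
  rw [mul_sub, pairIdem_mul_bipath, pairIdem_mul_bipath, if_pos h, if_pos h]

theorem arrowDiff_mul_pairIdem : arrowDiff φ * pairIdem φ (diagonalPairs Q) = arrowDiff φ := by
  rw [arrowDiff, Finset.sum_mul]
  refine Finset.sum_congr rfl fun α _ => ?_
  rw [sub_mul, bipath_mul_pairIdem, bipath_mul_pairIdem, if_pos (mem_diagonalPairs.2 rfl),
    if_pos (mem_diagonalPairs.2 rfl)]

theorem arrow_sub_mem_span_arrowDiff (harrow : ∀ {x y : Q} (α β : x ⟶ y), α = β) {x y : Q}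
    (α : x ⟶ y) : bipath φ α.toPath (Quiver.Path.nil : Quiver.Path y y) -
      bipath φ (Quiver.Path.nil : Quiver.Path x x) α.toPath ∈ Ideal.span {arrowDiff φ} := by
  -- Left multiplication by $e_x\otimes e_y$ keeps only the summands of arrows $x\to y$, and
  -- $\alpha$ is the only such arrow.
  refine Ideal.mem_span_singleton'.2 ⟨pairIdem φ {(x, y)}, ?_⟩
  rw [arrowDiff, Finset.mul_sum, Finset.sum_eq_single_of_mem ⟨x, y, α⟩ (Finset.mem_univ _)]
  · rw [mul_sub, pairIdem_mul_bipath, pairIdem_mul_bipath, if_pos (Finset.mem_singleton_self _),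
      if_pos (Finset.mem_singleton_self _)]
  · rintro ⟨x', y', β⟩ _ hβ
    have h : (x', y') ∉ ({(x, y)} : Finset (Q × Q)) := by
      rw [Finset.mem_singleton]
      intro h
      cases h
      exact hβ (by rw [harrow α β])
    rw [mul_sub, pairIdem_mul_bipath, pairIdem_mul_bipath, if_neg h, if_neg h, sub_zero]

theorem pathClass_sub_mem_span_arrowDiff (hφ : Function.Surjective φ)
    (harrow : ∀ {x y : Q} (α β : x ⟶ y), α = β)
    (a : A) :
    (a ⊗ₜ[k] (1 : Aᵐᵒᵖ)) * pairIdem φ (diagonalPairs Q) -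
      (1 ⊗ₜ[k] MulOpposite.op a) * pairIdem φ (diagonalPairs Q) ∈ Ideal.span {arrowDiff φ} := by
  induction a using pathClass_induction hφ with
  | h0 =>
    rw [zero_tmul, MulOpposite.op_zero, tmul_zero, sub_self]
    exact Ideal.zero_mem _
  | hadd a b ha hb =>
    rw [add_tmul, MulOpposite.op_add, tmul_add, add_mul, add_mul, add_sub_add_comm]
    exact Ideal.add_mem _ ha hb
  | hsmul c a ha =>
    -- Multiply the induction hypothesis by $c1\otimes 1$ and carry the scalar across the tensor
    -- sign in the second term.
    have h := Ideal.mul_mem_left (Ideal.span {arrowDiff φ})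
      ((c • 1 : A) ⊗ₜ[k] (1 : Aᵐᵒᵖ)) ha
    rwa [mul_sub, ← mul_assoc, ← mul_assoc, Algebra.TensorProduct.tmul_mul_tmul,
      Algebra.TensorProduct.tmul_mul_tmul, one_mul, one_mul, mul_one, smul_mul_assoc, one_mul,
      smul_tmul c (1 : A), ← MulOpposite.op_smul] at h
  | @hpath x y p =>
    rw [pathClass_tmul_one_mul_pairIdem, one_tmul_pathClass_mul_pairIdem]
    induction p with
    | nil =>
      rw [sub_self]
      exact Ideal.zero_mem _
    | @cons y z p α ih =>
      -- Telescoping: $p\alpha\otimes e_z-e_x\otimes p\alpha=(p\otimes e_z)(\alpha\otimes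
      -- e_z-e_y\otimes\alpha)+(e_x\otimes\alpha)(p\otimes e_y-e_x\otimes p)$.
      have h1 := Ideal.mul_mem_left (Ideal.span {arrowDiff φ})
        (bipath φ p (Quiver.Path.nil : Quiver.Path z z))
        (arrow_sub_mem_span_arrowDiff harrow α)
      have h2 := Ideal.mul_mem_left (Ideal.span {arrowDiff φ})
        (bipath φ (Quiver.Path.nil : Quiver.Path x x) α.toPath) ih
      rw [mul_sub, bipath_mul, bipath_mul] at h1 h2
      have := Ideal.add_mem _ h1 h2
      simp only [Quiver.Path.comp_nil, Quiver.Path.nil_comp,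
        Quiver.Path.comp_toPath_eq_cons] at this
      have hα : bipath φ p α.toPath = bipath φ p (Quiver.Path.nil.cons α) := rfl
      rwa [hα, sub_add_sub_cancel] at this

theorem exists_mul_arrowDiff_eq (hφ : Function.Surjective φ)
    (harrow : ∀ {x y : Q} (α β : x ⟶ y), α = β)
    (r : A ⊗[k] Aᵐᵒᵖ)
    (hr : r • toBimodule k A 1 = 0) :
    ∃ s, s * arrowDiff φ = r * pairIdem φ (diagonalPairs Q) := by
  exact Ideal.mem_span_singleton'.1
    (mul_mem_of_smul_one_eq_zero k (pathClass_sub_mem_span_arrowDiff hφ harrow) r hr)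

end BoundQuiver

/-! ### The kernel of right multiplication by $t$. -/

namespace PathAlgebra

variable {k : Type w} [Field k] {Q : Type u} [Quiver.{v} Q]

theorem coeff_mul_vertex {x y : Q} (p : Quiver.Path x y) (a : PathAlgebra k Q) :
    coeff p (a * vertex k y) = coeff p a := by
  suffices h : coeff p ∘ₗ mulRightMap (vertex k y) = coeff (k := k) p from LinearMap.congr_fun h a
  refine linearMap_ext fun {u v} q => ?_
  change coeff p (ofPath k q * ofPath k Quiver.Path.nil) = _
  by_cases h : v = y
  · subst h
    rw [ofPath_mul_ofPath, Quiver.Path.comp_nil]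
  · rw [ofPath_mul_ofPath_of_ne h, map_zero, coeff_ofPath_of_ne]
    intro h'
    cases h'
    exact h rfl

theorem coeff_vertex_mul {x y : Q} (p : Quiver.Path x y) (a : PathAlgebra k Q) :
    coeff p (vertex k x * a) = coeff p a := by
  suffices h : coeff p ∘ₗ mulMap (vertex k x) = coeff (k := k) p from LinearMap.congr_fun h a
  refine linearMap_ext fun {u v} q => ?_
  change coeff p (ofPath k Quiver.Path.nil * ofPath k q) = _
  by_cases h : x = u
  · subst h
    rw [ofPath_mul_ofPath, Quiver.Path.nil_comp]
  · rw [ofPath_mul_ofPath_of_ne h, map_zero, coeff_ofPath_of_ne]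
    intro h'
    cases h'
    exact h rfl

variable [Fintype (Σ x : Q, Σ y : Q, (x ⟶ y))]

theorem sum_coeff_mul_coeff_arrow_mul {x a b y : Q} (p : Quiver.Path x a) (α : a ⟶ b)
    (q : Quiver.Path b y) (m n : PathAlgebra k Q) :
    ∑ γ : Σ x : Q, Σ y : Q, (x ⟶ y), coeff p (m * vertex k γ.1) *
        coeff (α.toPath.comp q) (ofPath k γ.2.2.toPath * n) = coeff p m * coeff q n := by
  rw [Finset.sum_eq_single_of_mem ⟨a, b, α⟩ (Finset.mem_univ _)]
  · rw [coeff_mul_vertex, coeff_comp_mul]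
  · intro γ _ hγ
    rw [coeff_comp_mul_of_ne α q γ.2.2 hγ, mul_zero]

end PathAlgebra

namespace BoundQuiver

open PathAlgebra

variable {k : Type w} [Field k] {Q : Type u} [Quiver.{v} Q] [Fintype Q]
variable {A : Type t} [Ring A] [Algebra k A] {φ : PathAlgebra k Q →ₐ[k] A}
theorem pathClass_ne_zero_of_comp {x y z : Q} {p : Quiver.Path x y} {q : Quiver.Path y z}
    (h : pathClass φ (p.comp q) ≠ 0) : pathClass φ p ≠ 0 ∧ pathClass φ q ≠ 0 := by
  rw [← pathClass_mul] at h
  exact ⟨left_ne_zero_of_mul h, right_ne_zero_of_mul h⟩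

variable (hφ : Function.Surjective φ) (hmon : HasMonomialKernel φ)

/-- The coefficient of `p ⊗ q` in an element of the enveloping algebra. -/
noncomputable def biCoeff (p q : {p : QPath Q // pathClass φ p.2.2 ≠ 0}) : A ⊗[k] Aᵐᵒᵖ →ₗ[k] k :=
  ((pathClassBasis hφ hmon).tensorProduct
    ((pathClassBasis hφ hmon).map (MulOpposite.opLinearEquiv k))).coord (p, q)

theorem eq_of_biCoeff_eq {r s : A ⊗[k] Aᵐᵒᵖ}
    (h : ∀ p q, biCoeff hφ hmon p q r = biCoeff hφ hmon p q s) : r = s :=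
  ((pathClassBasis hφ hmon).tensorProduct
    ((pathClassBasis hφ hmon).map (MulOpposite.opLinearEquiv k))).ext_elem fun ⟨p, q⟩ => h p q

theorem biCoeff_tmul (p q : {p : QPath Q // pathClass φ p.2.2 ≠ 0}) (a b : PathAlgebra k Q) :
    biCoeff hφ hmon p q (φ a ⊗ₜ MulOpposite.op (φ b)) = coeff p.1.2.2 a * coeff q.1.2.2 b := by
  rw [biCoeff, Module.Basis.coord_apply, Module.Basis.tensorProduct_repr_tmul_apply,
    pathClassBasis_repr, Module.Basis.map_repr, LinearEquiv.trans_apply, smul_eq_mul, mul_comm]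
  congr 1
  exact pathClassBasis_repr hφ hmon q b

theorem biCoeff_bipath_of_ne {p q : {p : QPath Q // pathClass φ p.2.2 ≠ 0}} {a b c d : Q}
    {m : Quiver.Path a b} {n : Quiver.Path c d}
    (h : (⟨a, b, m⟩ : QPath Q) ≠ p.1 ∨ (⟨c, d, n⟩ : QPath Q) ≠ q.1) :
    biCoeff hφ hmon p q (bipath φ m n) = 0 := by
  refine (biCoeff_tmul hφ hmon p q _ _).trans ?_
  rcases h with h | h
  · rw [coeff_ofPath_of_ne h, zero_mul]
  · rw [coeff_ofPath_of_ne h, mul_zero]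

theorem biCoeff_pairIdem_mul [DecidableEq Q] (T : Finset (Q × Q))
    (p q : {p : QPath Q // pathClass φ p.2.2 ≠ 0}) (r : A ⊗[k] Aᵐᵒᵖ) :
    biCoeff hφ hmon p q (pairIdem φ T * r) =
      if (p.1.1, q.1.2.1) ∈ T then biCoeff hφ hmon p q r else 0 := by
  induction r using bipath_induction hφ with
  | h0 => rw [mul_zero, map_zero, ite_self]
  | hadd r s hr hs =>
    rw [mul_add, map_add, hr, hs, map_add]
    split_ifs
    · rfl
    · rw [add_zero]
  | hsmul c r hr =>
    rw [mul_smul_comm, map_smul, hr, map_smul]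
    split_ifs
    · rfl
    · rw [smul_zero]
  | @hpath a b c d m n =>
    rw [pairIdem_mul_bipath]
    by_cases h : (⟨a, b, m⟩ : QPath Q) = p.1 ∧ (⟨c, d, n⟩ : QPath Q) = q.1
    · rw [← h.1, ← h.2]
      split_ifs
      · rfl
      · rw [map_zero]
    · rw [not_and_or] at h
      have h0 := biCoeff_bipath_of_ne hφ hmon h
      split_ifs <;> simp only [h0, map_zero]

theorem biCoeff_mul_pairIdem [DecidableEq Q] (T : Finset (Q × Q))
    (p q : {p : QPath Q // pathClass φ p.2.2 ≠ 0}) (r : A ⊗[k] Aᵐᵒᵖ) :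
    biCoeff hφ hmon p q (r * pairIdem φ T) =
      if (p.1.2.1, q.1.1) ∈ T then biCoeff hφ hmon p q r else 0 := by
  induction r using bipath_induction hφ with
  | h0 => rw [zero_mul, map_zero, ite_self]
  | hadd r s hr hs =>
    rw [add_mul, map_add, hr, hs, map_add]
    split_ifs
    · rfl
    · rw [add_zero]
  | hsmul c r hr =>
    rw [smul_mul_assoc, map_smul, hr, map_smul]
    split_ifs
    · rfl
    · rw [smul_zero]
  | @hpath a b c d m n =>
    rw [bipath_mul_pairIdem]
    by_cases h : (⟨a, b, m⟩ : QPath Q) = p.1 ∧ (⟨c, d, n⟩ : QPath Q) = q.1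
    · rw [← h.1, ← h.2]
      split_ifs
      · rfl
      · rw [map_zero]
    · rw [not_and_or] at h
      have h0 := biCoeff_bipath_of_ne hφ hmon h
      split_ifs <;> simp only [h0, map_zero]

variable [Fintype (Σ x : Q, Σ y : Q, (x ⟶ y))]

theorem biCoeff_tmul_mul_arrowDiff (p q : {p : QPath Q // pathClass φ p.2.2 ≠ 0})
    (a b : PathAlgebra k Q) :
    biCoeff hφ hmon p q ((φ a ⊗ₜ MulOpposite.op (φ b)) * arrowDiff φ) =
      ∑ γ : Σ x : Q, Σ y : Q, (x ⟶ y), coeff p.1.2.2 (a * ofPath k γ.2.2.toPath) *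
          coeff q.1.2.2 (vertex k γ.2.1 * b) -
        ∑ γ : Σ x : Q, Σ y : Q, (x ⟶ y), coeff p.1.2.2 (a * vertex k γ.1) *
          coeff q.1.2.2 (ofPath k γ.2.2.toPath * b) := by
  rw [arrowDiff, Finset.mul_sum, map_sum, ← Finset.sum_sub_distrib]
  refine Finset.sum_congr rfl fun γ _ => ?_
  rw [mul_sub, map_sub, bipath, bipath, Algebra.TensorProduct.tmul_mul_tmul,
    Algebra.TensorProduct.tmul_mul_tmul, ← MulOpposite.op_mul, ← MulOpposite.op_mul, pathClass,
    pathClass, pathClass, ← map_mul, ← map_mul, ← map_mul, ← map_mul, biCoeff_tmul,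
    biCoeff_tmul]
  rfl

/-- A path ending in an arrow is never stationary, so only the summands $-e_x\otimes\gamma$ of $t$
contribute. -/
theorem biCoeff_nil_mul_arrowDiff {a b y : Q} (α : a ⟶ b) (q : Quiver.Path b y)
    (hp : pathClass φ (Quiver.Path.nil : Quiver.Path a a) ≠ 0) (hq : pathClass φ q ≠ 0)
    (hαq : pathClass φ (α.toPath.comp q) ≠ 0) (r : A ⊗[k] Aᵐᵒᵖ) :
    biCoeff hφ hmon ⟨⟨_, _, Quiver.Path.nil⟩, hp⟩ ⟨⟨_, _, α.toPath.comp q⟩, hαq⟩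
      (r * arrowDiff φ) = - biCoeff hφ hmon ⟨⟨_, _, Quiver.Path.nil⟩, hp⟩ ⟨⟨_, _, q⟩, hq⟩ r := by
  induction r using bipath_induction hφ with
  | h0 => rw [zero_mul, map_zero, map_zero, neg_zero]
  | hadd r s hr hs => rw [add_mul, map_add, hr, hs, map_add, neg_add]
  | hsmul c r hr => rw [smul_mul_assoc, map_smul, hr, map_smul, smul_neg]
  | hpath m n =>
    rw [bipath, pathClass, pathClass, biCoeff_tmul_mul_arrowDiff, biCoeff_tmul]
    dsimp only
    rw [sum_coeff_mul_coeff_arrow_mul, Finset.sum_eq_zero, zero_sub]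
    intro γ _
    rw [coeff_nil_mul, zero_mul]

/-- The term $p\beta\otimes\alpha q$ arises in just two ways: from $p\otimes\alpha q$ by
$\beta\otimes e_a$, and from $p\beta\otimes q$ by $-e_a\otimes\alpha$. -/
theorem biCoeff_cons_mul_arrowDiff {x c a b y : Q} (p : Quiver.Path x c) (β : c ⟶ a) (α : a ⟶ b)
    (q : Quiver.Path b y) (hp : pathClass φ p ≠ 0) (hpβ : pathClass φ (p.cons β) ≠ 0)
    (hq : pathClass φ q ≠ 0) (hαq : pathClass φ (α.toPath.comp q) ≠ 0) (r : A ⊗[k] Aᵐᵒᵖ) :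
    biCoeff hφ hmon ⟨⟨_, _, p.cons β⟩, hpβ⟩ ⟨⟨_, _, α.toPath.comp q⟩, hαq⟩ (r * arrowDiff φ) =
      biCoeff hφ hmon ⟨⟨_, _, p⟩, hp⟩ ⟨⟨_, _, α.toPath.comp q⟩, hαq⟩ r -
        biCoeff hφ hmon ⟨⟨_, _, p.cons β⟩, hpβ⟩ ⟨⟨_, _, q⟩, hq⟩ r := by
  induction r using bipath_induction hφ with
  | h0 => simp only [zero_mul, map_zero, sub_zero]
  | hadd r s hr hs =>
    rw [add_mul, map_add, hr, hs, map_add, map_add]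
    abel
  | hsmul c r hr => rw [smul_mul_assoc, map_smul, hr, map_smul, map_smul, smul_sub]
  | hpath m n =>
    rw [bipath, pathClass, pathClass, biCoeff_tmul_mul_arrowDiff, biCoeff_tmul, biCoeff_tmul]
    dsimp only
    rw [sum_coeff_mul_coeff_arrow_mul,
      Finset.sum_eq_single_of_mem ⟨c, a, β⟩ (Finset.mem_univ _)]
    · rw [coeff_cons_mul, coeff_vertex_mul]
    · intro γ _ hγ
      rw [coeff_cons_mul_of_ne p β γ.2.2 hγ, zero_mul]

/-- Induction on $p$ with $\alpha$ and $q$ free: $rt=0$ equates the coefficients at $p\beta\otimes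
q$ and $p\otimes\alpha q$, and the full path $p\beta\alpha q$, assumed non-zero in $A$, is the same
for both. -/
theorem biCoeff_eq_zero_of_mul_arrowDiff {r : A ⊗[k] Aᵐᵒᵖ} (hr : r * arrowDiff φ = 0) {x a : Q}
    (p : Quiver.Path x a) : ∀ {b y : Q} (α : a ⟶ b) (q : Quiver.Path b y)
    (hp : pathClass φ p ≠ 0) (hq : pathClass φ q ≠ 0),
      pathClass φ (p.comp (α.toPath.comp q)) ≠ 0 →
      biCoeff hφ hmon ⟨⟨_, _, p⟩, hp⟩ ⟨⟨_, _, q⟩, hq⟩ r = 0 := by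
  induction p with
  | nil =>
    intro b y α q hp hq h
    have := biCoeff_nil_mul_arrowDiff hφ hmon α q hp hq (pathClass_ne_zero_of_comp h).2 r
    rw [hr, map_zero] at this
    exact neg_eq_zero.1 this.symm
  | @cons c a p β ih =>
    intro b y α q hpβ hq h
    have hαq := (pathClass_ne_zero_of_comp h).2
    rw [← Quiver.Path.comp_toPath_eq_cons, Quiver.Path.comp_assoc] at h
    have hp := (pathClass_ne_zero_of_comp h).1
    have := biCoeff_cons_mul_arrowDiff hφ hmon p β α q hp hpβ hq hαq r
    rw [hr, map_zero, ih β (α.toPath.comp q) hp hαq h, zero_sub] at this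
    exact neg_eq_zero.1 this.symm

/-- This is $fK=K$. Outside $T$ the path $p\alpha q$ has non-zero class, so the previous lemma kills
the coefficient at $p\otimes q$. -/
theorem pairIdem_mul_eq_of_mul_arrowDiff [DecidableEq Q] (hφ : Function.Surjective φ)
    (hmon : HasMonomialKernel φ) {T : Finset (Q × Q)}
    (hT : ∀ {x y : Q} (p : Quiver.Path x y), pathClass φ p = 0 → (x, y) ∈ T)
    {r : A ⊗[k] Aᵐᵒᵖ} (hr : r * arrowDiff φ = 0) :
    pairIdem φ T * (r * pairIdem φ (arrowPairs Q)) = r * pairIdem φ (arrowPairs Q) := by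
  refine eq_of_biCoeff_eq hφ hmon fun p q => ?_
  rw [biCoeff_pairIdem_mul, biCoeff_mul_pairIdem]
  split_ifs with h1 h2 h2
  · rfl
  · rfl
  · obtain ⟨α⟩ := mem_arrowPairs.1 h2
    obtain ⟨⟨x, a, p⟩, hp⟩ := p
    obtain ⟨⟨b, y, q⟩, hq⟩ := q
    exact (biCoeff_eq_zero_of_mul_arrowDiff hφ hmon hr p α q hp hq
      fun h => h1 (hT _ h)).symm
  · rfl

end BoundQuiver

/-! ### The centre, the dimension counts and the conclusion. -/

namespace BoundQuiver

open PathAlgebra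

variable {k : Type w} [Field k] {Q : Type u} [Quiver.{v} Q]

theorem eq_of_isConnected {α : Type*} (hQ : IsConnected Q) (c : Q → α)
    (hc : ∀ {x y : Q}, (x ⟶ y) → c x = c y) (x y : Q) : c x = c y := by
  obtain ⟨p⟩ := hQ.2 x y
  induction p with
  | nil => rfl
  | cons p e ih =>
    refine ih.trans ?_
    rcases e with e | e
    · exact hc e
    · exact (hc e).symm

variable [Fintype Q]
variable {A : Type t} [Ring A] [Algebra k A] {φ : PathAlgebra k Q →ₐ[k] A}

section

variable [DecidableEq Q]

/-- Gives $\dim eA=|Q_0|$: $e_x$ is the only surviving path from $x$ to $x$. -/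
theorem exists_eq_sum_vertices (hφ : Function.Surjective φ) (hmon : HasMonomialKernel φ)
    (hnil : ∀ x : Q, pathClass φ (Quiver.Path.nil : Quiver.Path x x) ≠ 0)
    (huniq : ∀ {x y : Q} {p : Quiver.Path x y}, pathClass φ p ≠ 0 → ∀ q, q = p)
    (m : envelopingBimodule k A) (hm : pairIdem φ (diagonalPairs Q) • m = m) :
    ∃! c : Q → k, ∑ x, algebraMap k (A ⊗[k] Aᵐᵒᵖ) (c x) •
      toBimodule k A (pathClass φ (Quiver.Path.nil : Quiver.Path x x)) = m := by
  refine existsUnique_sum_of_pairIdem_smul hφ hmon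
    (fun x => (⟨x, x, Quiver.Path.nil⟩ : QPath Q)) ?_ hnil ?_ m hm
  · intro x y h
    exact congrArg Sigma.fst h
  · intro x y p hxy hp
    obtain rfl := mem_diagonalPairs.1 hxy
    exact ⟨x, by rw [huniq hp Quiver.Path.nil]⟩

/-- Gives $\dim dA=|Q_1|$: the only surviving path parallel to an arrow is that arrow. -/
theorem exists_eq_sum_arrows [Fintype (Σ x : Q, Σ y : Q, (x ⟶ y))]
    (hφ : Function.Surjective φ) (hmon : HasMonomialKernel φ)
    (harr : ∀ {x y : Q} (α : x ⟶ y), pathClass φ α.toPath ≠ 0)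
    (huniq : ∀ {x y : Q} {p : Quiver.Path x y}, pathClass φ p ≠ 0 → ∀ q, q = p)
    (m : envelopingBimodule k A) (hm : pairIdem φ (arrowPairs Q) • m = m) :
    ∃! c : (Σ x : Q, Σ y : Q, (x ⟶ y)) → k, ∑ α, algebraMap k (A ⊗[k] Aᵐᵒᵖ) (c α) •
      toBimodule k A (pathClass φ α.2.2.toPath) = m := by
  let π : (Σ x : Q, Σ y : Q, (x ⟶ y)) → QPath Q := fun α => ⟨α.1, α.2.1, α.2.2.toPath⟩
  have hπ : Function.Injective π := by
    rintro ⟨x, y, α⟩ ⟨x', y', β⟩ h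
    change (⟨x, y, α.toPath⟩ : QPath Q) = ⟨x', y', β.toPath⟩ at h
    cases h
    rfl
  refine existsUnique_sum_of_pairIdem_smul hφ hmon π hπ (fun α => harr α.2.2) ?_ m hm
  intro x y p hxy hp
  obtain ⟨α⟩ := mem_arrowPairs.1 hxy
  refine ⟨⟨x, y, α⟩, ?_⟩
  rw [← huniq hp α.toPath]

/-- The centre of `A` is reduced to the scalars. -/
theorem exists_eq_algebraMap_of_central (hQ : IsConnected Q) (hφ : Function.Surjective φ)
    (hmon : HasMonomialKernel φ)
    (hnil : ∀ x : Q, pathClass φ (Quiver.Path.nil : Quiver.Path x x) ≠ 0)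
    (harr : ∀ {x y : Q} (α : x ⟶ y), pathClass φ α.toPath ≠ 0)
    (huniq : ∀ {x y : Q} {p : Quiver.Path x y}, pathClass φ p ≠ 0 → ∀ q, q = p)
    {z : A} (hz : ∀ a, a * z = z * a) : ∃ c : k, z = c • 1 := by
  -- A central $z$ satisfies $\sum_x e_xze_x=z\sum_x e_x=z$, so it is a combination of vertices.
  have hm : pairIdem φ (diagonalPairs Q) • toBimodule k A z = toBimodule k A z := by
    rw [pairIdem, Finset.sum_smul, diagonalPairs, Finset.sum_image (by
      intro x _ y _ h
      exact congrArg Prod.fst h)]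
    simp only [bipath, tmul_smul_toBimodule]
    rw [← map_sum]
    congr 1
    calc ∑ x : Q, pathClass φ (Quiver.Path.nil : Quiver.Path x x) *
          (z * pathClass φ (Quiver.Path.nil : Quiver.Path x x))
        = ∑ x : Q, z * pathClass φ (Quiver.Path.nil : Quiver.Path x x) := by
          refine Finset.sum_congr rfl fun x _ => ?_
          rw [← mul_assoc, hz, mul_assoc, pathClass_mul, Quiver.Path.comp_nil]
      _ = z := by rw [← Finset.mul_sum, ← one_eq_sum_pathClass φ, mul_one]
  obtain ⟨c, hc, -⟩ := exists_eq_sum_vertices hφ hmon hnil huniq _ hm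
  simp only [algebraMap_smul_toBimodule, ← map_sum] at hc
  replace hc := (toBimodule k A).injective hc
  have hconst : ∀ {x y : Q}, (x ⟶ y) → c x = c y := by
    intro x y α
    -- For $z=\sum c_xe_x$, the identity $\alpha z=z\alpha$ reads $c_y\alpha=c_x\alpha$, and
    -- $\alpha\ne 0$ in $A$.
    have h := hz (pathClass φ α.toPath)
    rw [← hc, Finset.mul_sum, Finset.sum_mul, Finset.sum_eq_single_of_mem y (Finset.mem_univ y),
      Finset.sum_eq_single_of_mem x (Finset.mem_univ x), mul_smul_comm, smul_mul_assoc,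
      pathClass_mul, pathClass_mul, Quiver.Path.comp_nil, Quiver.Path.nil_comp, ← sub_eq_zero,
      ← sub_smul, smul_eq_zero_iff_left (harr α), sub_eq_zero] at h
    · exact h.symm
    · intro x' _ hx'
      rw [smul_mul_assoc, pathClass_mul_of_ne hx', smul_zero]
    · intro y' _ hy'
      rw [mul_smul_comm, pathClass_mul_of_ne (Ne.symm hy'), smul_zero]
  obtain ⟨x₀⟩ := hQ.1
  refine ⟨c x₀, ?_⟩
  rw [← hc, one_eq_sum_pathClass φ, Finset.smul_sum]
  exact Finset.sum_congr rfl fun x _ => by rw [eq_of_isConnected hQ c hconst x x₀]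

end

/-- A bimodule endomorphism is determined by the image of $1$, which is central by left and right
linearity. -/
theorem nonempty_linearEquiv_end_of_central [Nontrivial A]
    (hz : ∀ z : A, (∀ a, a * z = z * a) → ∃ c : k, z = c • 1) :
    Nonempty ((envelopingBimodule k A ⟶ envelopingBimodule k A) ≃ₗ[k] k) := by
  let F : k →ₗ[k] (envelopingBimodule k A ⟶ envelopingBimodule k A) :=
    LinearMap.toSpanSingleton k _ (𝟙 _)
  have hF : ∀ (c : k) (a : A), (F c).hom (toBimodule k A a) = toBimodule k A (c • a) :=
    fun c a => algebraMap_smul_toBimodule k c a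
  refine ⟨(LinearEquiv.ofBijective F ⟨?_, ?_⟩).symm⟩
  · intro c d h
    have := hF c 1
    rw [h, hF] at this
    have := (toBimodule k A).injective this
    exact (smul_left_injective k (one_ne_zero (α := A)) this).symm
  · intro ψ
    have hl : ∀ a : A, ψ.hom (toBimodule k A a) =
        toBimodule k A (a * (toBimodule k A).symm (ψ.hom (toBimodule k A 1))) := by
      intro a
      have h : toBimodule k A a = (a ⊗ₜ[k] MulOpposite.op (1 : A)) • toBimodule k A 1 := by
        rw [tmul_smul_toBimodule, one_mul, mul_one]
      obtain ⟨z, hz⟩ := (toBimodule k A).surjective (ψ.hom (toBimodule k A 1))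
      rw [h, map_smul, ← hz, tmul_smul_toBimodule, AddEquiv.symm_apply_apply, mul_one]
    have hr : ∀ a : A, ψ.hom (toBimodule k A a) =
        toBimodule k A ((toBimodule k A).symm (ψ.hom (toBimodule k A 1)) * a) := by
      intro a
      have h : toBimodule k A a = ((1 : A) ⊗ₜ[k] MulOpposite.op a) • toBimodule k A 1 := by
        rw [tmul_smul_toBimodule, one_mul, one_mul]
      obtain ⟨z, hz⟩ := (toBimodule k A).surjective (ψ.hom (toBimodule k A 1))
      rw [h, map_smul, ← hz, tmul_smul_toBimodule, AddEquiv.symm_apply_apply, one_mul]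
    obtain ⟨c, hc⟩ := hz _ fun a => (toBimodule k A).injective ((hl a).symm.trans (hr a))
    refine ⟨c, ?_⟩
    ext m
    obtain ⟨a, rfl⟩ := (toBimodule k A).surjective m
    rw [hF, hl, hc, mul_smul_comm, mul_one]

/-- The Hochschild cohomology of a quotient `A` of `kQ` by an ideal spanned by paths, such that
the paths with non-zero classes, among which are the vertices and the arrows, have no other
parallel paths. -/
theorem hochschildCohomology_of_path_unique [Fintype (Σ x : Q, Σ y : Q, (x ⟶ y))]
    (hQ : IsConnected Q) (hφ : Function.Surjective φ) (hmon : HasMonomialKernel φ)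
    (hnil : ∀ x : Q, pathClass φ (Quiver.Path.nil : Quiver.Path x x) ≠ 0)
    (harr : ∀ {x y : Q} (α : x ⟶ y), pathClass φ α.toPath ≠ 0)
    (huniq : ∀ {x y : Q} {p : Quiver.Path x y}, pathClass φ p ≠ 0 → ∀ q, q = p) :
    Nonempty (HochschildCohomology k A 0 ≃ₗ[k] k) ∧
    (Module.Finite k (HochschildCohomology k A 1) ∧
      Module.finrank k (HochschildCohomology k A 1) + Fintype.card Q =
        Fintype.card (Σ x : Q, Σ y : Q, (x ⟶ y)) + 1) ∧
    ∀ i : ℕ, Subsingleton (HochschildCohomology k A (i + 2)) := by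
  classical
  have hpar : ∀ {x y : Q} (p q : Quiver.Path x y), pathClass φ p = 0 → pathClass φ q = 0 := by
    intro x y p q hp
    by_contra hq
    rw [← huniq hq p] at hq
    exact hq hp
  obtain ⟨x₀⟩ := hQ.1
  have : Nontrivial A := ⟨_, _, hnil x₀⟩
  obtain ⟨e⟩ := nonempty_linearEquiv_end_of_central (k := k) (A := A) fun z =>
    exists_eq_algebraMap_of_central hQ hφ hmon hnil harr huniq
  refine ⟨⟨Abelian.Ext.linearEquiv₀ ≪≫ₗ e⟩, ?_⟩
  -- One zero path suffices for membership, which makes $T$ stable under composition; by `hpar` all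
  -- paths between such a pair are then zero, which gives $fA=0$.
  let T : Finset (Q × Q) := Finset.univ.filter fun x => ∃ p : Quiver.Path x.1 x.2, pathClass φ p = 0
  have hmemT : ∀ {x y : Q}, (x, y) ∈ T ↔ ∃ p : Quiver.Path x y, pathClass φ p = 0 := by
    intro x y
    simp [T]
  have harrow : ∀ {x y : Q} (α β : x ⟶ y), α = β := by
    intro x y α β
    have h := huniq (harr β) α.toPath
    exact eq_of_heq (Quiver.Path.hom_heq_of_cons_eq_cons h)
  have hE := nonempty_hom_span_idempotent_linearEquiv (k := k)
    (isIdempotentElem_pairIdem (φ := φ) (diagonalPairs Q)) (envelopingBimodule k A)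
    (fun x : Q => toBimodule k A (pathClass φ (Quiver.Path.nil : Quiver.Path x x)))
    (fun x => by rw [pairIdem_smul_pathClass, if_pos (mem_diagonalPairs.2 rfl)])
    (exists_eq_sum_vertices hφ hmon hnil huniq)
  have hD := nonempty_hom_span_idempotent_linearEquiv (k := k)
    (isIdempotentElem_pairIdem (φ := φ) (arrowPairs Q)) (envelopingBimodule k A)
    (fun α : Σ x : Q, Σ y : Q, (x ⟶ y) => toBimodule k A (pathClass φ α.2.2.toPath))
    (fun α => by rw [pairIdem_smul_pathClass, if_pos (mem_arrowPairs.2 ⟨α.2.2⟩)])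
    (exists_eq_sum_arrows hφ hmon harr huniq)
  obtain ⟨hfin, hrank, hvan⟩ := ext_of_idempotent_presentation (k := k)
    (isIdempotentElem_pairIdem (φ := φ) (diagonalPairs Q))
    (isIdempotentElem_pairIdem (φ := φ) (arrowPairs Q))
    (isIdempotentElem_pairIdem (φ := φ) T)
    (pairIdem_mul_mul_pairIdem hφ (by
      intro a b c d p q h
      obtain ⟨m, hm⟩ := hmemT.1 h
      refine hmemT.2 ⟨p.comp (m.comp q), ?_⟩
      rw [← pathClass_mul, ← pathClass_mul, hm, zero_mul, mul_zero]))
    pairIdem_mul_arrowDiff arrowDiff_mul_pairIdem (envelopingBimodule k A)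
    (pairIdem_smul_eq_zero hφ (by
      intro x y p h
      obtain ⟨m, hm⟩ := hmemT.1 h
      exact hpar m p hm))
    pairIdem_smul_one
    (by
      intro m
      obtain ⟨a, rfl⟩ := (toBimodule k A).surjective m
      exact ⟨a ⊗ₜ MulOpposite.op 1, by rw [tmul_smul_toBimodule, one_mul, mul_one]⟩)
    arrowDiff_smul_one (exists_mul_arrowDiff_eq hφ harrow)
    (fun r => pairIdem_mul_eq_of_mul_arrowDiff hφ hmon fun p hp => hmemT.2 ⟨p, hp⟩) hE hD
  rw [e.finrank_eq, Module.finrank_self] at hrank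
  exact ⟨⟨hfin, hrank⟩, hvan⟩

end BoundQuiver

theorem corollary6p5 {k : Type w} [Field k] {Q : Type u} [Quiver.{v} Q] [Fintype Q]
    [∀ x y : Q, Finite (x ⟶ y)] (hQ : BoundQuiver.IsConnected Q)
    (I : Ideal (PathAlgebra k Q)) [I.IsTwoSided] (hadm : BoundQuiver.IsAdmissible I)
    (hmon : BoundQuiver.IsMonomial I) (hsemi : BoundQuiver.IsSemicommutative I)
    (hschur : BoundQuiver.IsSchurian I) :
    Nonempty (HochschildCohomology k (PathAlgebra k Q ⧸ I) 0 ≃ₗ[k] k) ∧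
    (Module.Finite k (HochschildCohomology k (PathAlgebra k Q ⧸ I) 1) ∧
      (Module.finrank k (HochschildCohomology k (PathAlgebra k Q ⧸ I) 1) : ℤ) =
        1 - (Fintype.card Q : ℤ) + (Nat.card (Σ x : Q, Σ y : Q, (x ⟶ y)) : ℤ)) ∧
    ∀ i : ℕ, 2 ≤ i → Subsingleton (HochschildCohomology k (PathAlgebra k Q ⧸ I) i) := by
  let _ := Fintype.ofFinite (Σ x : Q, Σ y : Q, (x ⟶ y))
  have hker : ∀ a : PathAlgebra k Q, Ideal.Quotient.mkₐ k I a = 0 ↔ a ∈ I := fun a =>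
    Ideal.Quotient.eq_zero_iff_mem
  have hlen : ∀ {x y : Q} (p : Quiver.Path x y), p.length < 2 →
      BoundQuiver.pathClass (Ideal.Quotient.mkₐ k I) p ≠ 0 := fun p hp h =>
    hp.not_ge (BoundQuiver.two_le_length_of_mem hadm ((hker _).1 h))
  obtain ⟨h0, ⟨hfin, hrank⟩, hvan⟩ := BoundQuiver.hochschildCohomology_of_path_unique
    (φ := Ideal.Quotient.mkₐ k I) hQ (Ideal.Quotient.mkₐ_surjective k I)
    (fun a ha x y p hp =>
      (hker _).2 (BoundQuiver.ofPath_mem_of_coeff_ne_zero hmon ((hker a).1 ha) hp))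
    (fun x => hlen _ Nat.two_pos) (fun α => hlen _ Nat.one_lt_two)
    (fun hp q => BoundQuiver.path_unique hmon hsemi hschur (fun h => hp ((hker _).2 h)) q)
  refine ⟨h0, ⟨hfin, ?_⟩, fun i hi => ?_⟩
  · rw [Nat.card_eq_fintype_card]
    have h : (_ : ℤ) = _ := congrArg Nat.cast hrank
    push_cast at h
    linarith
  · obtain ⟨j, rfl⟩ := Nat.exists_eq_add_of_le' hi
    exact hvan j
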